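/- Write $e(t)=e^{2\pi i t}$ and $$F(x)=\sum_{n=1}^\infty \frac{e(n^2x)}{n}\qquad\Big(\text{the limit of } \sum_{n\le N}\tfrac{e(n^2x)}n\text{ as }N\to\infty\Big).$$ For an irreducible fraction $p/q$ with $q\ge 1$ put $\theta_{p/q}=q^{-1/2}\sum_{n=0}^{q-1}e(pn^2/q)$. Fix a finite continued fraction expansion $p/q=[0;a_1,\dots,a_{j_0}]$ with $j_0\ge 0$ and positive integers $a_i$ (either of the two possible ones), and let $I=I_{p/q}$ be the interval of the $x\in[0,1)$ whose continued fraction expansion starts with $[0;a_1,\dots,a_{j_0},\dots]$, i.e. whose $j_0$-th convergent is $p/q$ (up to endpoints). Then the series $F$ converges almost everywhere in $[0,1)$ and $F$ is integrable there, so that the average $F_I=\frac1{|I|}\int_I F$ is meaningful, and the following holds. For every irrational $x\in I$, with convergents $p_j/q_j=[0;a_1(x),\dots,a_j(x)]$, $j\ge 0$ (so $p_0/q_0=0/1$), the series $F(x)$ converges if and only if the series $$\sum_{j\ge 0,\ q_j\ge q}\frac{\theta_{p_j/q_j}}{\sqrt{q_j}}\log\frac{q_{j+1}}{q_j}$$ (summed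 in increasing order of $j$) converges, and in this case $$F(x)-F_I=\frac12\sum_{j\ge 0,\ q_j\ge q}\frac{\theta_{p_j/q_j}}{\sqrt{q_j}}\log\frac{q_{j+1}}{q_j}+O\Big(\frac1{\sqrt q}\Big),$$ with an absolute $O$-constant, i.e. one independent of $p/q$, of the chosen expansion and of $x$. -/

import Mathlib

open Filter Topology MeasureTheory

noncomputable section

namespace QuadSeries

/-- The additive character `e(x) = exp(2πix)`. -/
def e (x : ℝ) : ℂ := Complex.exp (2 * Real.pi * Complex.I * x)

/-- The partial sum over `1 ≤ n ≤ N` of the Fourier series `∑ e(n²x)/n`. -/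
def partialSum (x : ℝ) (N : ℕ) : ℂ :=
  ∑ n ∈ Finset.Icc 1 N, e ((n : ℝ) ^ 2 * x) / (n : ℂ)

/-- The Fourier series `∑ e(n²x)/n` converges (in the usual sense) at `x`. -/
def SeriesConverges (x : ℝ) : Prop :=
  ∃ z : ℂ, Tendsto (partialSum x) atTop (𝓝 z)

/-- The sum `F(x)` of the Fourier series; it is only meaningful where the series converges. -/
def F (x : ℝ) : ℂ := limUnder atTop (partialSum x)

/-- The normalized quadratic Gauss sum of the irreducible fraction `r = p/q`, where
`p = r.num` and `q = r.den`. -/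
def theta (r : ℚ) : ℂ :=
  (1 / (Real.sqrt (r.den : ℝ) : ℂ)) *
    ∑ n ∈ Finset.range r.den, e ((r.num : ℝ) * (n : ℝ) ^ 2 / (r.den : ℝ))

/-- `convDen x j` is the denominator `q_j` of the `j`-th convergent `p_j/q_j = [a₀; a₁, …, a_j]`
of `x` (so `q₀ = 1`). -/
def convDen (x : ℝ) (j : ℕ) : ℕ := (x.convergent j).den

/-- The interval `I_{p/q}` for the fraction `r = p/q = [0; a₁, …, a_{j₀}]`, where the length
`j₀` records which of the two expansions of `r` has been fixed: the numbers in `[0,1)` whose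
convergent of index `j₀` is `r`. -/
def cfInterval (r : ℚ) (j₀ : ℕ) : Set ℝ :=
  {x : ℝ | x ∈ Set.Ico (0 : ℝ) 1 ∧ x.convergent j₀ = r}

/-- The average of `F` over a set `s` with respect to Lebesgue measure. -/
def mean (s : Set ℝ) : ℂ := ⨍ y in s, F y

/-- The partial sum over the indices `j < J` of
`(1/2) ∑_{q_j ≥ q} θ_{p_j/q_j} q_j^{-1/2} log (q_{j+1}/q_j)`. -/
def convPartialSum (q : ℕ) (x : ℝ) (J : ℕ) : ℂ :=
  (1 / 2) * ∑ j ∈ (Finset.range J).filter (fun j => q ≤ convDen x j),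
    theta (x.convergent j) / (Real.sqrt (convDen x j : ℝ) : ℂ) *
      (Real.log ((convDen x (j + 1) : ℝ) / (convDen x j : ℝ)) : ℂ)

end QuadSeries

end

noncomputable section

namespace QuadSeries

/-! Since `∫₀^∞ 2 exp(-π n² w²) dw = 1/n`, the series is formally the integral over `w > 0` of `θ(2x
+ iw²) - 1`, with `θ` the Jacobi theta function. Cutting the integral at `w = 1/N` (`thetaTail`)
smooths the partial sum of length `N`. For irrational `x` the two differ by `o(1)`: Weyl's estimate
for the sums of `e(n²x)` is fed into Abel summation (`tendsto_partialSum_sub_thetaTail`).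

The range of `w` is then cut at the points `1/q_j`. On `[1/q_{j+1}, 1/q_j]` the modular
transformation at the cusp `p_j/q_j` replaces `θ` by `θ_{p_j/q_j} q_j^{-1/2} z^{-1/2}` with `z = w²
- 2i(x - p_j/q_j)`. This behaves like `1/w` above `w ≈ (q_j q_{j+1})^{-1/2}` and is harmless below
it, so the integral is half of the `j`-th term up to `O(q_j^{-1/2})` (`arc_estimate`). As `q_j` at
least doubles every two steps, the errors sum to `O(q^{-1/2})` (`exists_remainder`). Hence both
series converge together, and `F(x)` is `thetaTail x (1/q)` plus the continued fraction series plus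
`O(q^{-1/2})`.

It remains to replace `thetaTail x (1/q)` by the mean of `F`. Across `I` this quantity varies by
only `O(q^{-1/2})`, by Cauchy's estimate for `θ'` (`norm_thetaTail_sub_le`). The continued fraction
series has mean absolute size `O(q^{-1/2})` over `I`, because on each cylinder its terms have only
an inverse square root singularity (`lintegral_tsum_termSize_le`). The latter bound also gives
convergence almost everywhere and integrability. -/

/-! ### Additive characters and quadratic Gauss sums -/

lemma norm_e (x : ℝ) : ‖e x‖ = 1 := by
  have h : e x = Complex.exp ((2 * Real.pi * x : ℝ) * Complex.I) := by
    unfold e; congr 1; push_cast; ring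
  rw [h, Complex.norm_exp_ofReal_mul_I]

lemma e_add (x y : ℝ) : e (x + y) = e x * e y := by
  unfold e; rw [← Complex.exp_add]; congr 1; push_cast; ring

lemma e_int (n : ℤ) : e n = 1 := by
  unfold e
  rw [Complex.exp_eq_one_iff]
  exact ⟨n, by push_cast; ring⟩

lemma e_conj (x : ℝ) : (starRingEnd ℂ) (e x) = e (-x) := by
  unfold e
  rw [← Complex.exp_conj]
  congr 1
  simp [map_ofNat]

/-- The quadratic Gauss sum with a linear term. -/
def quadGauss (p : ℤ) (q : ℕ) (k : ℤ) : ℂ :=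
  ∑ n ∈ Finset.range q, e (((p * (n : ℤ) ^ 2 + k * n : ℤ) : ℝ) / q)

lemma e_div_eq_stdAddChar (q : ℕ) [NeZero q] (m : ℤ) :
    e ((m : ℝ) / q) = ZMod.stdAddChar (m : ZMod q) := by
  rw [ZMod.stdAddChar_coe]; unfold e; congr 1; push_cast; ring

lemma sum_range_eq_sum_zmod (q : ℕ) [NeZero q] (f : ZMod q → ℂ) :
    ∑ n ∈ Finset.range q, f (n : ZMod q) = ∑ a : ZMod q, f a := by
  refine Finset.sum_bij' (fun n _ => (n : ZMod q)) (fun a _ => a.val) (by simp) ?_ ?_ ?_ (by simp)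
  · intro a _; simpa using ZMod.val_lt a
  · intro n hn; exact ZMod.val_cast_of_lt (by simpa using hn)
  · intro a _; simp

lemma quadGauss_eq_sum_zmod (p : ℤ) (q : ℕ) [NeZero q] (k : ℤ) :
    quadGauss p q k =
      ∑ a : ZMod q, ZMod.stdAddChar ((p : ZMod q) * a ^ 2 + (k : ZMod q) * a) := by
  rw [quadGauss, ← sum_range_eq_sum_zmod]
  refine Finset.sum_congr rfl fun n _ => ?_
  rw [e_div_eq_stdAddChar]; push_cast; rfl

/-- Weyl differencing: squaring leaves `q` times a sum of unimodular terms over the solutions of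
`2pu = 0` in `ZMod q`, and there are at most two because `p` is a unit. Uniformity in `k` is needed
because every frequency occurs in the dual theta series. -/
lemma norm_quadGauss_sq_le (p : ℤ) (q : ℕ) [NeZero q] (hpq : IsCoprime p (q : ℤ)) (k : ℤ) :
    ‖quadGauss p q k‖ ^ 2 ≤ 2 * q := by
  classical
  rw [quadGauss_eq_sum_zmod]
  set ψ : AddChar (ZMod q) ℂ := ZMod.stdAddChar with hψ
  set P : ZMod q := (p : ZMod q)
  set K : ZMod q := (k : ZMod q)
  have hP : IsUnit P := by
    obtain ⟨a, b, hab⟩ := hpq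
    refine IsUnit.of_mul_eq_one (a : ZMod q) ?_
    have := congrArg (Int.cast : ℤ → ZMod q) hab
    push_cast at this
    simp only [ZMod.natCast_self, mul_zero, add_zero] at this
    rw [mul_comm]; exact this
  have hconj : ∀ a : ZMod q, (starRingEnd ℂ) (ψ a) = ψ (-a) := fun a => by
    rw [AddChar.map_neg_eq_conj]
  have h1 : ((‖∑ a : ZMod q, ψ (P * a ^ 2 + K * a)‖ ^ 2 : ℝ) : ℂ) =
      ∑ u : ZMod q, ψ (P * u ^ 2 + K * u) * (if 2 * P * u = 0 then (q : ℂ) else 0) := by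
    rw [Complex.ofReal_pow, ← Complex.mul_conj', map_sum, Finset.sum_mul_sum, Finset.sum_comm]
    have : ∀ d : ZMod q, ∑ b : ZMod q, ψ (P * b ^ 2 + K * b) *
        (starRingEnd ℂ) (ψ (P * d ^ 2 + K * d)) =
        ∑ u : ZMod q, ψ (P * u ^ 2 + K * u) * ψ (d * (2 * P * u)) := by
      intro d
      -- After `b = u + d` the terms in `d` alone cancel, leaving a complete character sum in `d`.
      rw [← Equiv.sum_comp (Equiv.addRight d)]
      refine Finset.sum_congr rfl fun u _ => ?_
      rw [hconj, ← AddChar.map_add_eq_mul, ← AddChar.map_add_eq_mul]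
      congr 1
      simp only [Equiv.coe_addRight]; ring
    simp_rw [this]
    rw [Finset.sum_comm]
    refine Finset.sum_congr rfl fun u _ => ?_
    rw [← Finset.mul_sum, AddChar.sum_mulShift _ (ZMod.isPrimitive_stdAddChar q)]
    simp [ZMod.card]
  have h2 : ‖∑ a : ZMod q, ψ (P * a ^ 2 + K * a)‖ ^ 2 ≤
      ∑ u : ZMod q, (if 2 * P * u = 0 then (q : ℝ) else 0) := by
    have := congrArg norm h1
    rw [Complex.norm_real, Real.norm_of_nonneg (by positivity)] at this
    rw [this]
    refine (norm_sum_le _ _).trans (Finset.sum_le_sum fun u _ => ?_)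
    rw [norm_mul, hψ, ZMod.stdAddChar_apply, Circle.norm_coe]
    split_ifs <;> simp
  refine h2.trans ?_
  rw [← Finset.sum_filter, Finset.sum_const, nsmul_eq_mul]
  gcongr
  have h3 : (Finset.univ.filter fun u : ZMod q => 2 * P * u = 0).card ≤ 2 := by
    refine le_trans (Finset.card_le_card ?_)
      (IsAddCyclic.card_nsmul_eq_zero_le (α := ZMod q) (n := 2) (by norm_num))
    intro u hu
    simp only [Finset.mem_filter, Finset.mem_univ, true_and] at hu ⊢
    have : P * (2 * u) = 0 := by rw [← hu]; ring
    rw [nsmul_eq_mul]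
    exact (hP.mul_right_eq_zero).mp this
  exact_mod_cast h3

lemma norm_quadGauss_le (p : ℤ) (q : ℕ) [NeZero q] (hpq : IsCoprime p (q : ℤ)) (k : ℤ) :
    ‖quadGauss p q k‖ ≤ √2 * √q := by
  rw [← Real.sqrt_mul (by norm_num)]
  exact Real.le_sqrt_of_sq_le (norm_quadGauss_sq_le p q hpq k)

lemma theta_eq_quadGauss (r : ℚ) :
    theta r = (1 / (Real.sqrt (r.den : ℝ) : ℂ)) * quadGauss r.num r.den 0 := by
  unfold theta quadGauss
  congr 1
  refine Finset.sum_congr rfl fun n _ => ?_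
  congr 1; push_cast; ring

lemma isCoprime_num_den (r : ℚ) : IsCoprime r.num (r.den : ℤ) := by
  rw [Int.isCoprime_iff_gcd_eq_one]
  exact r.reduced

lemma norm_theta_le (r : ℚ) : ‖theta r‖ ≤ √2 := by
  have : NeZero r.den := ⟨r.den_nz⟩
  rw [theta_eq_quadGauss, norm_mul, norm_div, norm_one, Complex.norm_real,
    Real.norm_of_nonneg (Real.sqrt_nonneg _)]
  have h := norm_quadGauss_le r.num r.den (isCoprime_num_den r) 0
  have hd : 0 < √(r.den : ℝ) := Real.sqrt_pos.mpr (by exact_mod_cast r.den_pos)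
  rw [one_div_mul_eq_div, div_le_iff₀ hd]
  exact h

/-! ### The theta function near a rational cusp -/

lemma sum_exp_neg_sq_le {Y : ℝ} (hY : 0 < Y) (N : ℕ) :
    ∑ k ∈ Finset.range N, Real.exp (-Real.pi * ((k : ℝ) + 1) ^ 2 * Y) ≤ 1 / (2 * √Y) := by
  have hanti : AntitoneOn (fun t : ℝ => Real.exp (-(Real.pi * Y) * t ^ 2))
      (Set.Icc (0 : ℝ) (0 + N)) := by
    intro a ha b hb hab
    apply Real.exp_le_exp.mpr
    have : a ^ 2 ≤ b ^ 2 := pow_le_pow_left₀ ha.1 hab 2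
    have hp : 0 < Real.pi * Y := by positivity
    nlinarith
  have h := hanti.sum_le_integral
  have hint := integrable_exp_neg_mul_sq (b := Real.pi * Y) (by positivity)
  calc ∑ k ∈ Finset.range N, Real.exp (-Real.pi * ((k : ℝ) + 1) ^ 2 * Y)
      = ∑ k ∈ Finset.range N, Real.exp (-(Real.pi * Y) * (0 + ((k + 1 : ℕ) : ℝ)) ^ 2) := by
        refine Finset.sum_congr rfl fun k _ => ?_
        congr 1; push_cast; ring
    _ ≤ _ := h
    _ = ∫ t in Set.Ioc (0 : ℝ) (0 + N), Real.exp (-(Real.pi * Y) * t ^ 2) := by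
        rw [intervalIntegral.integral_of_le (by simp)]
    _ ≤ ∫ t in Set.Ioi (0 : ℝ), Real.exp (-(Real.pi * Y) * t ^ 2) := by
        refine setIntegral_mono_set hint.integrableOn
          (Eventually.of_forall fun _ => (Real.exp_pos _).le) ?_
        exact (Set.Ioc_subset_Ioi_self).eventuallyLE
    _ = 1 / (2 * √Y) := by
        rw [integral_gaussian_Ioi]
        have : Real.pi / (Real.pi * Y) = 1 / Y := by field_simp
        rw [this, Real.sqrt_div (by norm_num), Real.sqrt_one]; field_simp

lemma tail_gaussian_bound {Y c : ℝ} (hY : 0 < Y) {f : ℕ → ℂ}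
    (hf : ∀ k : ℕ, ‖f k‖ ≤ c * Real.exp (-Real.pi * ((k : ℝ) + 1) ^ 2 * Y)) :
    Summable f ∧ ‖∑' k, f k‖ ≤ c * (1 / (2 * √Y)) := by
  have hc : 0 ≤ c := by
    have h0 := (norm_nonneg _).trans (hf 0)
    exact nonneg_of_mul_nonneg_left h0 (Real.exp_pos _)
  have hb : ∀ N, ∑ k ∈ Finset.range N, ‖f k‖ ≤ c * (1 / (2 * √Y)) := fun N =>
    calc _ ≤ ∑ k ∈ Finset.range N, c * Real.exp (-Real.pi * ((k : ℝ) + 1) ^ 2 * Y) :=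
          Finset.sum_le_sum fun k _ => hf k
      _ ≤ _ := by
          rw [← Finset.mul_sum]
          exact mul_le_mul_of_nonneg_left (sum_exp_neg_sq_le hY N) hc
  have hs : Summable fun k => ‖f k‖ :=
    summable_of_sum_range_le (fun _ => norm_nonneg _) hb
  exact ⟨hs.of_norm, (norm_tsum_le_tsum_norm hs).trans
    (Real.tsum_le_of_sum_range_le (fun _ => norm_nonneg _) hb)⟩

/-- Isolates the zero frequency, which gives the main term at a cusp. Comparison of the remaining
sum with a Gaussian integral is enough; no exponential decay in `Y` is used. -/
lemma norm_tsum_int_sub_le {Y c : ℝ} (hY : 0 < Y) {f : ℤ → ℂ}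
    (hf : ∀ k : ℤ, ‖f k‖ ≤ c * Real.exp (-Real.pi * (k : ℝ) ^ 2 * Y)) :
    Summable f ∧ ‖∑' k, f k - f 0‖ ≤ c / √Y := by
  obtain ⟨s1, b1⟩ := tail_gaussian_bound (f := fun n : ℕ => f (n + 1)) (c := c) hY
    (fun k => by simpa using hf (k + 1))
  obtain ⟨s2, b2⟩ := tail_gaussian_bound (f := fun n : ℕ => f (-(n + 1))) (c := c) hY
    (fun k => by
      have := hf (-(k + 1))
      push_cast at this
      rwa [neg_sq] at this)
  have h1 : HasSum (fun n : ℕ => f n) (f 0 + ∑' n : ℕ, f (n + 1)) := by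
    have := s1.hasSum
    rw [← hasSum_nat_add_iff' 1]
    simpa using this
  have h := h1.of_nat_of_neg_add_one s2.hasSum
  refine ⟨h.summable, ?_⟩
  rw [h.tsum_eq]
  calc _ = ‖∑' n : ℕ, f (n + 1) + ∑' n : ℕ, f (-(n + 1))‖ := by congr 1; ring
    _ ≤ c * (1 / (2 * √Y)) + c * (1 / (2 * √Y)) := (norm_add_le _ _).trans (add_le_add b1 b2)
    _ = c / √Y := by field_simp; ring

lemma re_neg_div_ofReal_mul {z : ℂ} (a b : ℝ) :
    ((-a / (b * z) : ℂ)).re = -a / b * (z.re / ‖z‖ ^ 2) := by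
  have : (-a / (b * z) : ℂ) = ((-a / b : ℝ) : ℂ) * z⁻¹ := by push_cast; field_simp
  rw [this, Complex.re_ofReal_mul, Complex.inv_re, Complex.normSq_eq_norm_sq]

/-- Poisson summation along a residue class. -/
lemma tsum_gaussian_residue (q : ℕ) [NeZero q] (b : ℕ) {z : ℂ} (hz : 0 < z.re) :
    ∑' m : ℤ, Complex.exp (-Real.pi * ((m * q + b : ℤ) : ℂ) ^ 2 * z) =
      1 / (q * z ^ (1 / 2 : ℂ)) * ∑' k : ℤ, e (((k * b : ℤ) : ℝ) / q) *
        Complex.exp (-Real.pi * (k : ℂ) ^ 2 / (q ^ 2 * z)) := by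
  have hq : (0 : ℝ) < q := by exact_mod_cast Nat.pos_of_ne_zero (NeZero.ne q)
  have hqc : (q : ℂ) ≠ 0 := by exact_mod_cast hq.ne'
  have hz0 : z ≠ 0 := fun h => by simp [h] at hz
  set a : ℂ := ((q : ℝ) ^ 2 : ℝ) * z with ha
  have har : 0 < a.re := by rw [ha, Complex.re_ofReal_mul]; positivity
  have ha0 : a ≠ 0 := fun h => by simp [h] at har
  have h := Complex.tsum_exp_neg_quadratic har (-(b : ℂ) * q * z)
  -- The principal root factors because `q²` is a positive real.
  have ha' : a ^ (1 / 2 : ℂ) = q * z ^ (1 / 2 : ℂ) := by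
    rw [Complex.cpow_def_of_ne_zero ha0, Complex.cpow_def_of_ne_zero hz0, ha,
      Complex.log_ofReal_mul (by positivity) hz0, Real.log_pow, add_mul, Complex.exp_add]
    congr 1
    have : ((2 : ℕ) * Real.log q : ℝ) * (1 / 2 : ℂ) = ((Real.log q : ℝ) : ℂ) := by
      push_cast; ring
    rw [this, ← Complex.ofReal_exp, Real.exp_log hq, Complex.ofReal_natCast]
  rw [ha'] at h
  have h2 : ∀ m : ℤ, Complex.exp (-Real.pi * ((m * q + b : ℤ) : ℂ) ^ 2 * z) =
      Complex.exp (-Real.pi * b ^ 2 * z) *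
        Complex.exp (-Real.pi * a * m ^ 2 + 2 * Real.pi * (-(b : ℂ) * q * z) * m) := by
    intro m
    rw [← Complex.exp_add, ha]; congr 1; push_cast; ring
  simp_rw [h2]
  rw [tsum_mul_left, h, mul_left_comm, ← tsum_mul_left]
  congr 1
  refine tsum_congr fun k => ?_
  rw [e, ← Complex.exp_add, ← Complex.exp_add, ha]
  congr 1
  push_cast
  field_simp
  ring_nf
  rw [Complex.I_sq]
  ring

/-- The modular transformation of the theta series near a rational cusp. -/
lemma jacobiTheta_cusp (p : ℤ) (q : ℕ) [NeZero q] {z : ℂ}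
    (hz : 0 < z.re) :
    jacobiTheta (2 * p / q + Complex.I * z) = 1 / (q * z ^ (1 / 2 : ℂ)) *
      ∑' k : ℤ, quadGauss p q k * Complex.exp (-Real.pi * (k : ℂ) ^ 2 / (q ^ 2 * z)) := by
  have hq : (0 : ℝ) < q := by exact_mod_cast Nat.pos_of_ne_zero (NeZero.ne q)
  have hqc : (q : ℂ) ≠ 0 := by exact_mod_cast hq.ne'
  have hz0 : z ≠ 0 := fun h => by simp [h] at hz
  set τ : ℂ := 2 * p / q + Complex.I * z with hτ
  have him : 0 < τ.im := by
    have : (2 * p / q : ℂ) = ((2 * p / q : ℝ) : ℂ) := by push_cast; rfl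
    rw [hτ, this, Complex.add_im, Complex.ofReal_im, Complex.I_mul_im, zero_add]; exact hz
  have hsum : Summable fun n : ℤ => Complex.exp (Real.pi * Complex.I * (n : ℂ) ^ 2 * τ) := by
    have := (hasSum_jacobiTheta₂_term 0 him).summable
    refine this.congr fun n => ?_
    simp [jacobiTheta₂_term]
  have hY : 0 < z.re / (q ^ 2 * ‖z‖ ^ 2) := by positivity
  have hexp : ∀ k : ℤ, ‖Complex.exp (-Real.pi * (k : ℂ) ^ 2 / (q ^ 2 * z))‖ =
      Real.exp (-Real.pi * (k : ℝ) ^ 2 * (z.re / (q ^ 2 * ‖z‖ ^ 2))) := by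
    intro k
    rw [Complex.norm_exp]
    have := re_neg_div_ofReal_mul (z := z) (Real.pi * (k : ℝ) ^ 2) ((q : ℝ) ^ 2)
    push_cast at this
    rw [neg_mul, this]
    congr 1; field_simp
  have hs : ∀ b : ℕ, Summable fun k : ℤ => e (((k * b : ℤ) : ℝ) / q) *
        Complex.exp (-Real.pi * (k : ℂ) ^ 2 / (q ^ 2 * z)) := fun b =>
    (norm_tsum_int_sub_le (c := 1) hY (fun k => by
      rw [norm_mul, norm_e, one_mul, one_mul, hexp])).1
  have hterm : ∀ x : Fin q × ℤ, Complex.exp (Real.pi * Complex.I *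
      (((x.2 * q + (x.1 : ℕ) : ℤ)) : ℂ) ^ 2 * τ) =
      e (((p * ((x.1 : ℕ) : ℤ) ^ 2 : ℤ) : ℝ) / q) *
        Complex.exp (-Real.pi * ((x.2 * q + (x.1 : ℕ) : ℤ) : ℂ) ^ 2 * z) := by
    rintro ⟨b, m⟩
    -- For `n = mq + b`, the number `pn²/q` exceeds `pb²/q` by the integer `p(m²q + 2mb)`.
    have : e (((p * ((b : ℕ) : ℤ) ^ 2 : ℤ) : ℝ) / q) =
        e (((p * ((b : ℕ) : ℤ) ^ 2 : ℤ) : ℝ) / q) *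
          e ((p * (m ^ 2 * q + 2 * m * b) : ℤ)) := by
      rw [e_int, mul_one]
    rw [this, ← e_add, e, ← Complex.exp_add]
    congr 1
    rw [hτ]
    push_cast
    field_simp
    ring_nf
    rw [Complex.I_sq]
    ring
  calc jacobiTheta τ = ∑' n : ℤ, Complex.exp (Real.pi * Complex.I * (n : ℂ) ^ 2 * τ) := rfl
    _ = ∑' x : Fin q × ℤ, Complex.exp (Real.pi * Complex.I *
          (((x.2 * q + (x.1 : ℕ) : ℤ)) : ℂ) ^ 2 * τ) := by
        rw [← ((Int.divModEquiv q).symm.tsum_eq), ← (Equiv.prodComm _ _).tsum_eq]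
        rfl
    _ = ∑ b : Fin q, ∑' m : ℤ, Complex.exp (Real.pi * Complex.I *
          (((m * q + (b : ℕ) : ℤ)) : ℂ) ^ 2 * τ) := by
        rw [Summable.tsum_prod, tsum_fintype]
        rw [← (Int.divModEquiv q).symm.summable_iff, ← (Equiv.prodComm _ _).summable_iff] at hsum
        exact hsum
    _ = ∑ b : Fin q, e (((p * ((b : ℕ) : ℤ) ^ 2 : ℤ) : ℝ) / q) * (1 / (q * z ^ (1 / 2 : ℂ)) *
          ∑' k : ℤ, e (((k * (b : ℕ) : ℤ) : ℝ) / q) *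
            Complex.exp (-Real.pi * (k : ℂ) ^ 2 / (q ^ 2 * z))) := by
        refine Finset.sum_congr rfl fun b _ => ?_
        rw [← tsum_gaussian_residue q b hz, ← tsum_mul_left]
        exact tsum_congr fun m => hterm (b, m)
    _ = 1 / (q * z ^ (1 / 2 : ℂ)) * ∑ b : Fin q, ∑' k : ℤ,
          e (((p * ((b : ℕ) : ℤ) ^ 2 : ℤ) : ℝ) / q) * (e (((k * (b : ℕ) : ℤ) : ℝ) / q) *
            Complex.exp (-Real.pi * (k : ℂ) ^ 2 / (q ^ 2 * z))) := by
        rw [Finset.mul_sum]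
        refine Finset.sum_congr rfl fun b _ => ?_
        rw [tsum_mul_left]; ring
    _ = _ := by
        congr 1
        rw [← Summable.tsum_finsetSum (fun (b : Fin q) _ => (hs b).mul_left
          (e (((p * ((b : ℕ) : ℤ) ^ 2 : ℤ) : ℝ) / q)))]
        refine tsum_congr fun k => ?_
        rw [quadGauss, Finset.sum_mul, Finset.sum_range]
        refine Finset.sum_congr rfl fun b _ => ?_
        rw [← mul_assoc, ← e_add]
        congr 2
        push_cast; ring

lemma norm_cpow_half (z : ℂ) : ‖z ^ (1 / 2 : ℂ)‖ = √‖z‖ := by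
  have : (1 / 2 : ℂ) = ((1 / 2 : ℝ) : ℂ) := by push_cast; rfl
  rw [this, Complex.norm_cpow_real, Real.sqrt_eq_rpow]

/-- The main term is the zero frequency of the dual series. The others are bounded by
`norm_tsum_int_sub_le` with `Y = Re z / (q²|z|²)`, using the uniform Gauss sum bound. -/
lemma norm_jacobiTheta_sub_main_le (r : ℚ) {z : ℂ} (hz : 0 < z.re) :
    ‖jacobiTheta (2 * (r : ℂ) + Complex.I * z) -
        theta r / (√(r.den : ℝ) : ℂ) / z ^ (1 / 2 : ℂ)‖ ≤
      √2 * √(r.den : ℝ) * √‖z‖ / √z.re := by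
  have : NeZero r.den := ⟨r.den_nz⟩
  have hz0 : z ≠ 0 := fun h => by simp [h] at hz
  set q := r.den with hqdef
  have hq : (0 : ℝ) < q := by exact_mod_cast r.den_pos
  have hqc : (q : ℂ) ≠ 0 := by exact_mod_cast hq.ne'
  have hzh : z ^ (1 / 2 : ℂ) ≠ 0 := by
    rw [Complex.cpow_def_of_ne_zero hz0]; exact Complex.exp_ne_zero _
  have hY : 0 < z.re / (q ^ 2 * ‖z‖ ^ 2) := by positivity
  have hr : (2 * (r : ℂ)) = 2 * (r.num : ℂ) / (q : ℂ) := by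
    rw [mul_div_assoc, hqdef]; congr 1; exact Rat.cast_def r
  have hb := (norm_tsum_int_sub_le (c := √2 * √q) hY
    (f := fun k : ℤ => quadGauss r.num q k *
      Complex.exp (-Real.pi * (k : ℂ) ^ 2 / (q ^ 2 * z))) (fun k => by
      rw [norm_mul, Complex.norm_exp]
      have := re_neg_div_ofReal_mul (z := z) (Real.pi * (k : ℝ) ^ 2) ((q : ℝ) ^ 2)
      push_cast at this
      rw [neg_mul, this]
      have h2 : -(Real.pi * (k : ℝ) ^ 2) / (q : ℝ) ^ 2 * (z.re / ‖z‖ ^ 2) =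
        -Real.pi * (k : ℝ) ^ 2 * (z.re / (q ^ 2 * ‖z‖ ^ 2)) := by field_simp
      rw [h2]
      gcongr
      exact norm_quadGauss_le _ _ (isCoprime_num_den r) k)).2
  rw [hr, jacobiTheta_cusp r.num q hz]
  have hth : theta r / (√(q : ℝ) : ℂ) / z ^ (1 / 2 : ℂ) =
      1 / (q * z ^ (1 / 2 : ℂ)) * (quadGauss r.num q 0 *
        Complex.exp (-Real.pi * ((0 : ℤ) : ℂ) ^ 2 / (q ^ 2 * z))) := by
    rw [theta_eq_quadGauss, ← hqdef]
    have hs : ((√(q : ℝ) : ℝ) : ℂ) ≠ 0 := by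
      exact_mod_cast (Real.sqrt_pos.mpr hq).ne'
    have hs2 : ((√(q : ℝ) : ℝ) : ℂ) ^ 2 = q := by
      rw [← Complex.ofReal_pow, Real.sq_sqrt hq.le, Complex.ofReal_natCast]
    simp only [Int.cast_zero, ne_eq, OfNat.ofNat_ne_zero, not_false_eq_true, zero_pow, mul_zero,
      zero_div, Complex.exp_zero, mul_one]
    rw [← hs2]
    field_simp
  rw [hth, ← mul_sub, norm_mul, norm_div, norm_one, norm_mul, norm_cpow_half z,
    Complex.norm_natCast]
  have hzn : 0 < ‖z‖ := norm_pos_iff.mpr hz0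
  calc _ ≤ 1 / (q * √‖z‖) * (√2 * √q / √(z.re / (q ^ 2 * ‖z‖ ^ 2))) := by gcongr
    _ = _ := by
      rw [Real.sqrt_div hz.le, ← mul_pow, Real.sqrt_sq (by positivity)]
      have h3 := Real.sqrt_pos.mpr hz
      have h4 := Real.sqrt_pos.mpr hzn
      have h5 : ‖z‖ = √‖z‖ ^ 2 := (Real.sq_sqrt hzn.le).symm
      field_simp
      nth_rewrite 1 [h5]
      ring

/-! ### The theta integral over one arc -/

/-- The full theta series at `2x + iw²`. -/
def thetaAt (x w : ℝ) : ℂ := jacobiTheta (2 * (x : ℂ) + Complex.I * (w : ℂ) ^ 2)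

/-- The local parameter `w² - 2ih` at a cusp. -/
def cuspParam (h w : ℝ) : ℂ := (w : ℂ) ^ 2 - 2 * Complex.I * h

lemma cuspParam_re (h w : ℝ) : (cuspParam h w).re = w ^ 2 := by
  simp [cuspParam, ← Complex.ofReal_pow]

lemma cuspParam_im (h w : ℝ) : (cuspParam h w).im = -(2 * h) := by
  simp [cuspParam, ← Complex.ofReal_pow]

lemma sq_le_norm_cuspParam (h w : ℝ) : w ^ 2 ≤ ‖cuspParam h w‖ := by
  rw [← cuspParam_re h w]; exact Complex.re_le_norm _

lemma two_abs_le_norm_cuspParam (h w : ℝ) : 2 * |h| ≤ ‖cuspParam h w‖ := by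
  have := Complex.abs_im_le_norm (cuspParam h w)
  rwa [cuspParam_im, abs_neg, abs_mul, abs_two] at this

lemma norm_cuspParam_le (h w : ℝ) : ‖cuspParam h w‖ ≤ w ^ 2 + 2 * |h| := by
  refine (norm_sub_le _ _).trans ?_
  simp

lemma cuspParam_ne_zero {h w : ℝ} (hw : 0 < w) : cuspParam h w ≠ 0 := fun h0 => by
  have := cuspParam_re h w
  rw [h0] at this
  have : 0 < w ^ 2 := by positivity
  simp_all

lemma thetaAt_eq (r : ℚ) (x w : ℝ) :
    thetaAt x w = jacobiTheta (2 * (r : ℂ) + Complex.I * cuspParam (x - r) w) := by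
  unfold thetaAt cuspParam
  congr 1
  push_cast
  ring_nf
  rw [Complex.I_sq]
  ring

lemma norm_thetaAt_sub_main_le (r : ℚ) (x : ℝ) {w : ℝ} (hw : 0 < w) :
    ‖thetaAt x w - theta r / (√(r.den : ℝ) : ℂ) / cuspParam (x - r) w ^ (1 / 2 : ℂ)‖ ≤
      √2 * √(r.den : ℝ) * (1 + √(2 * |x - r|) / w) := by
  have hre : 0 < (cuspParam (x - r) w).re := by rw [cuspParam_re]; positivity
  have h := norm_jacobiTheta_sub_main_le r hre
  rw [← thetaAt_eq, cuspParam_re, Real.sqrt_sq hw.le, mul_div_assoc] at h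
  refine h.trans ?_
  gcongr
  rw [div_le_iff₀ hw, add_mul, one_mul, div_mul_cancel₀ _ hw.ne']
  refine (Real.sqrt_le_sqrt (norm_cuspParam_le _ _)).trans ?_
  have h0 := Real.sq_sqrt (show 0 ≤ 2 * |x - r| by positivity)
  have h1 := Real.sqrt_nonneg (2 * |x - r|)
  refine Real.sqrt_le_iff.mpr ⟨by positivity, ?_⟩
  nlinarith

lemma norm_inv_cusp_le_inv (h : ℝ) {w : ℝ} (hw : 0 < w) :
    ‖1 / cuspParam h w ^ (1 / 2 : ℂ)‖ ≤ 1 / w := by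
  rw [norm_div, norm_one, norm_cpow_half]
  gcongr
  exact Real.le_sqrt_of_sq_le (sq_le_norm_cuspParam h w)

lemma norm_inv_cusp_le_inv_sqrt {h : ℝ} (hh : h ≠ 0) (w : ℝ) :
    ‖1 / cuspParam h w ^ (1 / 2 : ℂ)‖ ≤ 1 / √(2 * |h|) := by
  rw [norm_div, norm_one, norm_cpow_half]
  have : 0 < |h| := abs_pos.mpr hh
  gcongr
  exact two_abs_le_norm_cuspParam h w

lemma cpow_half_sq {z : ℂ} : (z ^ (1 / 2 : ℂ)) ^ 2 = z := by
  rw [← Complex.cpow_nat_mul]; simp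

/-- With `s = z^{1/2}` one has `1/s - 1/w = 2ih / (s w (s + w))`. Since the principal root has
nonnegative real part, `|s + w| ≥ w`; also `|s| ≥ w`. -/
lemma norm_inv_cusp_sub_inv_le (h : ℝ) {w : ℝ} (hw : 0 < w) :
    ‖1 / cuspParam h w ^ (1 / 2 : ℂ) - 1 / (w : ℂ)‖ ≤ 2 * |h| / w ^ 3 := by
  set z := cuspParam h w with hz
  have hz0 : z ≠ 0 := cuspParam_ne_zero hw
  set s := z ^ (1 / 2 : ℂ) with hs
  have hs0 : s ≠ 0 := by
    rw [hs, Complex.cpow_def_of_ne_zero hz0]; exact Complex.exp_ne_zero _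
  have hsre : 0 ≤ s.re := by
    have hre : 0 < z.re := by rw [hz, cuspParam_re]; positivity
    have harg := Complex.abs_arg_lt_pi_div_two_iff.mpr (Or.inl hre)
    rw [hs, Complex.cpow_def_of_ne_zero hz0, Complex.exp_re]
    have him : (Complex.log z * (1 / 2)).im = z.arg / 2 := by
      have : Complex.log z * (1 / 2) = ((1 / 2 : ℝ) : ℂ) * Complex.log z := by
        push_cast; ring
      rw [this, Complex.im_ofReal_mul, Complex.log_im]; ring
    rw [him]
    refine mul_nonneg (Real.exp_pos _).le (Real.cos_nonneg_of_mem_Icc ?_)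
    have := abs_lt.mp harg
    constructor <;> linarith [Real.pi_pos]
  have hws : w ≤ ‖s + w‖ := by
    calc w ≤ (s + w).re := by simp; exact hsre
      _ ≤ _ := Complex.re_le_norm _
  have hwc : (w : ℂ) ≠ 0 := by exact_mod_cast hw.ne'
  have hsw0 : s + w ≠ 0 := fun h0 => by rw [h0, norm_zero] at hws; linarith
  have hsn : w ≤ ‖s‖ := by
    rw [hs, norm_cpow_half]
    exact Real.le_sqrt_of_sq_le (sq_le_norm_cuspParam h w)
  have key : 1 / s - 1 / (w : ℂ) = (2 * Complex.I * h) / (s * w * (s + w)) := by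
    have h2 : s ^ 2 = z := cpow_half_sq
    have h3 : z = (w : ℂ) ^ 2 - 2 * Complex.I * h := rfl
    field_simp
    linear_combination -h2 - h3
  rw [key, norm_div]
  have hn : ‖(2 * Complex.I * h : ℂ)‖ = 2 * |h| := by simp
  rw [hn, norm_mul, norm_mul, Complex.norm_real, Real.norm_of_nonneg hw.le]
  have : w ^ 3 = w * w * w := by ring
  rw [this]
  gcongr

lemma continuousOn_inv_cusp (h : ℝ) :
    ContinuousOn (fun w : ℝ => 1 / cuspParam h w ^ (1 / 2 : ℂ)) (Set.Ioi 0) := by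
  intro w hw
  have hw : 0 < w := hw
  apply ContinuousAt.continuousWithinAt
  refine ContinuousAt.div continuousAt_const ?_ ?_
  · refine ContinuousAt.cpow ?_ continuousAt_const ?_
    · unfold cuspParam; fun_prop
    · left; rw [cuspParam_re]; positivity
  · rw [Complex.cpow_def_of_ne_zero (cuspParam_ne_zero hw)]; exact Complex.exp_ne_zero _

lemma thetaAt_im_pos (x : ℝ) {w : ℝ} (hw : 0 < w) :
    0 < (2 * (x : ℂ) + Complex.I * (w : ℂ) ^ 2).im := by
  simp [← Complex.ofReal_pow]; positivity

lemma continuousOn_thetaAt (x : ℝ) : ContinuousOn (thetaAt x) (Set.Ioi 0) := by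
  intro w hw
  apply ContinuousAt.continuousWithinAt
  unfold thetaAt
  exact ContinuousAt.comp (f := fun w : ℝ => 2 * (x : ℂ) + Complex.I * (w : ℂ) ^ 2)
    (continuousAt_jacobiTheta (thetaAt_im_pos x hw)) (by fun_prop)

lemma intervalIntegrable_of_continuousOn_Ioi {f : ℝ → ℂ} (hf : ContinuousOn f (Set.Ioi 0))
    {a b : ℝ} (ha : 0 < a) (hb : 0 < b) : IntervalIntegrable f volume a b := by
  refine (hf.mono fun t ht => ?_).intervalIntegrable
  exact lt_of_lt_of_le (lt_min ha hb) ht.1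

lemma integral_inv_cube_le {m b : ℝ} (hm : 0 < m) (hmb : m ≤ b) :
    ∫ w in m..b, 1 / w ^ 3 ≤ 1 / (2 * m ^ 2) := by
  have h : ∀ w : ℝ, 1 / w ^ 3 = w ^ (-3 : ℤ) := fun w => by
    rw [zpow_neg, one_div]; norm_cast
  have hb : 0 < b := hm.trans_le hmb
  simp_rw [h]
  rw [integral_zpow (Or.inr ⟨by norm_num, Set.notMem_uIcc_of_lt hm hb⟩)]
  have e1 : b ^ ((-3 : ℤ) + 1) = 1 / b ^ 2 := by
    rw [show ((-3 : ℤ) + 1) = -2 by norm_num, zpow_neg, one_div]; norm_cast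
  have e2 : m ^ ((-3 : ℤ) + 1) = 1 / m ^ 2 := by
    rw [show ((-3 : ℤ) + 1) = -2 by norm_num, zpow_neg, one_div]; norm_cast
  rw [e1, e2]
  have : 0 < 1 / b ^ 2 := by positivity
  have e3 : 1 / (2 * m ^ 2) = 1 / m ^ 2 / 2 := by field_simp
  rw [e3, show (((-3 : ℤ) : ℝ) + 1) = -2 by norm_num, div_neg, ← neg_div]
  gcongr
  linarith

lemma integral_inv_eq_log {m b : ℝ} (hm : 0 < m) (hb : 0 < b) :
    ∫ w in m..b, 1 / w = Real.log (b / m) := integral_one_div_of_pos hm hb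

lemma intervalIntegrable_inv {m b : ℝ} (hm : 0 < m) (hb : 0 < b) :
    IntervalIntegrable (fun w : ℝ => 1 / w) volume m b :=
  intervalIntegral.intervalIntegrable_one_div
    (fun _ hx => (lt_of_lt_of_le (lt_min hm hb) hx.1).ne') continuousOn_id

/-- Below `m` the offset `h` dominates `w²`: the integrand is at most `1/m` on an interval of length
at most `m`. -/
lemma integral_cusp_initial_le {a m h : ℝ} (ha : 0 < a) (ham : a ≤ m) (h1 : m ^ 2 ≤ 2 * |h|) :
    ∫ w in a..m, ‖1 / cuspParam h w ^ (1 / 2 : ℂ)‖ ≤ 1 := by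
  have hm : 0 < m := ha.trans_le ham
  have hh : h ≠ 0 := fun h0 => by
    rw [h0, abs_zero] at h1; have : 0 < m ^ 2 := by positivity
    linarith
  have hκ : m ≤ √(2 * |h|) := Real.le_sqrt_of_sq_le h1
  calc _ ≤ ∫ w in a..m, 1 / m := by
        refine intervalIntegral.integral_mono_on ham
          (intervalIntegrable_of_continuousOn_Ioi (continuousOn_inv_cusp h) ha hm).norm
          intervalIntegrable_const fun w _ => ?_
        refine (norm_inv_cusp_le_inv_sqrt hh w).trans ?_
        gcongr
    _ ≤ 1 := by
        rw [intervalIntegral.integral_const, smul_eq_mul, mul_one_div, div_le_one hm]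
        linarith

lemma integral_norm_cusp_le {a m b h : ℝ} (ha : 0 < a) (ham : a ≤ m) (hmb : m ≤ b)
    (h1 : m ^ 2 ≤ 2 * |h|) :
    ∫ w in a..b, ‖1 / cuspParam h w ^ (1 / 2 : ℂ)‖ ≤ 1 + Real.log (b / m) := by
  have hm : 0 < m := ha.trans_le ham
  have hb : 0 < b := hm.trans_le hmb
  have hi := fun {s t : ℝ} (hs : 0 < s) (ht : 0 < t) =>
    (intervalIntegrable_of_continuousOn_Ioi (continuousOn_inv_cusp h) hs ht).norm
  rw [← intervalIntegral.integral_add_adjacent_intervals (hi ha hm) (hi hm hb)]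
  refine add_le_add (integral_cusp_initial_le ha ham h1) ?_
  rw [← integral_inv_eq_log hm hb]
  refine intervalIntegral.integral_mono_on hmb (hi hm hb) (intervalIntegrable_inv hm hb)
    fun w hw => norm_inv_cusp_le_inv h (hm.trans_le hw.1)

/-- The point `m`, with `m²` comparable to `|h|`, separates the two regimes: below it the integral
is at most 1, above it replacing the integrand by `1/w` costs at most `∫ 2|h|/w³ ≤ 1`. -/
lemma norm_integral_cusp_sub_log_le {a m b h : ℝ} (ha : 0 < a) (ham : a ≤ m) (hmb : m ≤ b)
    (h1 : m ^ 2 ≤ 2 * |h|) (h2 : |h| ≤ m ^ 2) :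
    ‖(∫ w in a..b, 1 / cuspParam h w ^ (1 / 2 : ℂ)) - (Real.log (b / m) : ℂ)‖ ≤ 2 := by
  have hm : 0 < m := ha.trans_le ham
  have hb : 0 < b := hm.trans_le hmb
  have hi := fun {s t : ℝ} (hs : 0 < s) (ht : 0 < t) =>
    (intervalIntegrable_of_continuousOn_Ioi (continuousOn_inv_cusp h) hs ht)
  have hlog : (Real.log (b / m) : ℂ) = ∫ w in m..b, (1 / w : ℂ) := by
    rw [← integral_inv_eq_log hm hb, ← intervalIntegral.integral_ofReal]
    simp
  have hinv : IntervalIntegrable (fun w : ℝ => (1 / w : ℂ)) volume m b := by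
    refine intervalIntegrable_of_continuousOn_Ioi (fun w hw => ?_) hm hb
    have : (w : ℂ) ≠ 0 := by exact_mod_cast (ne_of_gt hw)
    exact ContinuousAt.continuousWithinAt (by fun_prop (disch := assumption))
  rw [← intervalIntegral.integral_add_adjacent_intervals (hi ha hm) (hi hm hb), hlog,
    add_sub_assoc, ← intervalIntegral.integral_sub (hi hm hb) hinv]
  refine (norm_add_le _ _).trans ?_
  have e1 := (intervalIntegral.norm_integral_le_integral_norm ham).trans
    (integral_cusp_initial_le ha ham h1)
  have hc : IntervalIntegrable (fun w : ℝ => 2 * |h| * (1 / w ^ 3)) volume m b := by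
    apply ContinuousOn.intervalIntegrable
    intro w hw
    have : 0 < w := lt_of_lt_of_le (lt_min hm hb) hw.1
    apply ContinuousAt.continuousWithinAt
    have : w ^ 3 ≠ 0 := by positivity
    fun_prop (disch := assumption)
  have e2 : ‖∫ w in m..b, (1 / cuspParam h w ^ (1 / 2 : ℂ) - 1 / w : ℂ)‖ ≤ 1 := by
    calc _ ≤ ∫ w in m..b, 2 * |h| * (1 / w ^ 3) := by
          refine intervalIntegral.norm_integral_le_of_norm_le hmb ?_ hc
          refine Eventually.of_forall fun w hw => ?_
          rw [mul_one_div]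
          exact norm_inv_cusp_sub_inv_le h (hm.trans hw.1)
      _ = 2 * |h| * ∫ w in m..b, 1 / w ^ 3 := intervalIntegral.integral_const_mul _ _
      _ ≤ 2 * |h| * (1 / (2 * m ^ 2)) := by
          gcongr; exact integral_inv_cube_le hm hmb
      _ ≤ 1 := by
          rw [mul_one_div, div_le_one (by positivity)]; linarith
  linarith

/-- No logarithm survives: `log(b/a) ≤ 2√(b/a)`, and `κ ≤ √(2ab)` turns this into a multiple of `b`.
-/
lemma integral_error_le {a b : ℝ} {κ : ℝ} (ha : 0 < a) (hab : a ≤ b)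
    (hκ : κ ^ 2 ≤ 2 * (a * b)) :
    ∫ w in a..b, (1 + κ / w) ≤ 4 * b := by
  have hb : 0 < b := ha.trans_le hab
  have : ∀ w : ℝ, 1 + κ / w = 1 + κ * (1 / w) := fun w => by rw [mul_one_div]
  simp_rw [this]
  rw [intervalIntegral.integral_add intervalIntegrable_const
    ((intervalIntegrable_inv ha hb).const_mul κ), intervalIntegral.integral_const_mul,
    integral_inv_eq_log ha hb, intervalIntegral.integral_const, smul_eq_mul, mul_one]
  have hlog : Real.log (b / a) ≤ 2 * √(b / a) := by
    have h1 : Real.log (b / a) = 2 * Real.log √(b / a) := by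
      rw [Real.log_sqrt (by positivity)]; ring
    have h2 := Real.log_le_sub_one_of_pos (x := √(b / a)) (by positivity)
    linarith
  have hκ' : κ ≤ √2 * √(a * b) := by
    rw [← Real.sqrt_mul (by norm_num)]; exact Real.le_sqrt_of_sq_le hκ
  have h2 : √2 ≤ 3 / 2 := by
    rw [Real.sqrt_le_left (by norm_num)]; norm_num
  have hs : √(a * b) * √(b / a) = b := by
    rw [← Real.sqrt_mul (by positivity)]
    have : a * b * (b / a) = b ^ 2 := by field_simp
    rw [this, Real.sqrt_sq hb.le]
  have : κ * Real.log (b / a) ≤ 3 * b := by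
    calc κ * Real.log (b / a) ≤ (√2 * √(a * b)) * (2 * √(b / a)) :=
          mul_le_mul hκ' hlog (Real.log_nonneg (by rw [le_div_iff₀ ha]; linarith)) (by positivity)
      _ = 2 * √2 * (√(a * b) * √(b / a)) := by ring
      _ = 2 * √2 * b := by rw [hs]
      _ ≤ 3 * b := by nlinarith
  linarith

lemma sqrt_two_le : √2 ≤ 3 / 2 := by
  rw [Real.sqrt_le_left (by norm_num)]; norm_num

/-- The theta integral over a range between consecutive denominators. -/
lemma arc_estimate (r : ℚ) (x Q : ℝ) (hQ : (r.den : ℝ) ≤ Q)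
    (h1 : 1 / (2 * r.den * Q) ≤ |x - r|) (h2 : |x - r| ≤ 1 / (r.den * Q)) :
    ‖(∫ w in (1 / Q)..(1 / r.den), (thetaAt x w - 1)) -
      1 / 2 * (theta r / (√(r.den : ℝ) : ℂ) * (Real.log (Q / r.den) : ℂ))‖ ≤
        11 / √(r.den : ℝ) ∧
    ∀ w₀ : ℝ, 1 / Q ≤ w₀ → w₀ ≤ 1 / r.den →
      ‖∫ w in w₀..(1 / r.den), (thetaAt x w - 1)‖ ≤
        1 / 2 * ‖theta r / (√(r.den : ℝ) : ℂ) * (Real.log (Q / r.den) : ℂ)‖ +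
          11 / √(r.den : ℝ) := by
  set q : ℝ := (r.den : ℝ) with hq
  have hq1 : 1 ≤ q := by rw [hq]; exact_mod_cast r.den_pos
  have hq0 : 0 < q := by linarith
  have hQ0 : 0 < Q := by linarith
  set h : ℝ := x - r with hh
  set a : ℝ := 1 / Q with ha
  set b : ℝ := 1 / q with hb
  -- The geometric mean of the endpoints: the hypotheses place `|x - r|` between `ab/2` and `ab`. As
  -- `log(b/m)` is half of `log(Q/q)`, this choice produces the factor `1/2` of the theorem.
  set m : ℝ := √(a * b) with hm
  set κ : ℝ := √(2 * |h|) with hκ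
  have ha0 : 0 < a := by positivity
  have hb0 : 0 < b := by positivity
  have hab : a ≤ b := by rw [ha, hb]; gcongr
  have hm2 : m ^ 2 = a * b := Real.sq_sqrt (by positivity)
  have hm0 : 0 < m := Real.sqrt_pos.mpr (by positivity)
  have ham : a ≤ m := Real.le_sqrt_of_sq_le (by nlinarith)
  have hmb : m ≤ b := Real.sqrt_le_iff.mpr ⟨hb0.le, by nlinarith⟩
  have habq : a * b = 1 / (q * Q) := by rw [ha, hb]; field_simp
  have hm1 : m ^ 2 ≤ 2 * |h| := by
    rw [hm2, habq]
    calc 1 / (q * Q) = 2 * (1 / (2 * q * Q)) := by field_simp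
      _ ≤ _ := by linarith
  have hm3 : |h| ≤ m ^ 2 := by rw [hm2, habq]; exact h2
  have hκ2 : κ ^ 2 ≤ 2 * (a * b) := by
    rw [hκ, Real.sq_sqrt (by positivity)]; linarith
  set s : ℝ := √q with hs
  have hs0 : 0 < s := Real.sqrt_pos.mpr hq0
  have hs1 : 1 ≤ s := Real.one_le_sqrt.mpr hq1
  have hss : s ^ 2 = q := Real.sq_sqrt hq0.le
  set c : ℂ := theta r / (s : ℂ) with hc
  have hcn : ‖c‖ ≤ √2 / s := by
    rw [hc, norm_div, Complex.norm_real, Real.norm_of_nonneg hs0.le]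
    gcongr
    exact norm_theta_le r
  have hlogm : Real.log (b / m) = 1 / 2 * Real.log (Q / q) := by
    have : b / m = √(Q / q) := by
      rw [div_eq_iff hm0.ne', hm, ← Real.sqrt_mul (by positivity)]
      have : Q / q * (a * b) = b ^ 2 := by rw [ha, hb]; field_simp
      rw [this, Real.sqrt_sq hb0.le]
    rw [this, Real.log_sqrt (by positivity)]; ring
  have hlog0 : 0 ≤ Real.log (Q / q) :=
    Real.log_nonneg (by rw [le_div_iff₀ hq0]; linarith)
  have hbs : b = 1 / s / s := by rw [hb, ← hss]; field_simp
  have hb1 : b ≤ 1 / s := by rw [hbs]; exact div_le_self (by positivity) hs1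
  have hsb : s * b = 1 / s := by rw [hbs]; field_simp
  have hg : ContinuousOn (fun w : ℝ => c * (1 / cuspParam h w ^ (1 / 2 : ℂ))) (Set.Ioi 0) :=
    continuousOn_const.mul (continuousOn_inv_cusp h)
  have hf : ContinuousOn (fun w : ℝ => thetaAt x w - 1) (Set.Ioi 0) :=
    (continuousOn_thetaAt x).sub continuousOn_const
  -- The cusp error is of order `√q · (1 + κ/w)`, whose integral is `O(√q · b) = O(1/√q)`; the
  -- subtracted 1 contributes at most `b ≤ 1/√q`.
  have herr : ∀ w₀, a ≤ w₀ → w₀ ≤ b →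
      ‖(∫ w in w₀..b, (thetaAt x w - 1)) -
        c * ∫ w in w₀..b, 1 / cuspParam h w ^ (1 / 2 : ℂ)‖ ≤ 7 / s := by
    intro w₀ haw hwb
    have hw0 : 0 < w₀ := ha0.trans_le haw
    rw [← intervalIntegral.integral_const_mul, ← intervalIntegral.integral_sub
      (intervalIntegrable_of_continuousOn_Ioi hf hw0 hb0)
      (intervalIntegrable_of_continuousOn_Ioi hg hw0 hb0)]
    have hi : ∀ {t : ℝ}, 0 < t → IntervalIntegrable
        (fun w => 1 + √2 * s * (1 + κ / w)) volume t b := by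
      intro t ht
      have : ∀ w : ℝ, κ / w = κ * (1 / w) := fun w => by rw [mul_one_div]
      simp_rw [this]
      exact intervalIntegrable_const.add
        ((intervalIntegrable_const.add ((intervalIntegrable_inv ht hb0).const_mul κ)).const_mul _)
    have hi' : IntervalIntegrable (fun w => 1 + κ / w) volume a b := by
      have : ∀ w : ℝ, κ / w = κ * (1 / w) := fun w => by rw [mul_one_div]
      simp_rw [this]
      exact intervalIntegrable_const.add ((intervalIntegrable_inv ha0 hb0).const_mul κ)
    calc _ ≤ ∫ w in w₀..b, (1 + √2 * s * (1 + κ / w)) := by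
          refine intervalIntegral.norm_integral_le_of_norm_le hwb ?_ (hi hw0)
          refine Eventually.of_forall fun w hw => ?_
          have hw' : 0 < w := hw0.trans hw.1
          have := norm_thetaAt_sub_main_le r x hw'
          calc _ = ‖(thetaAt x w - c / cuspParam h w ^ (1 / 2 : ℂ)) - 1‖ := by
                congr 1; rw [mul_one_div]; ring
            _ ≤ √2 * s * (1 + κ / w) + 1 := by
                refine (norm_sub_le _ _).trans ?_
                rw [norm_one]
                gcongr
            _ = _ := by ring
      _ ≤ ∫ w in a..b, (1 + √2 * s * (1 + κ / w)) := by
          refine intervalIntegral.integral_mono_interval haw hwb le_rfl ?_ (hi ha0)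
          refine (ae_restrict_mem measurableSet_Ioc).mono fun w hw => ?_
          have : 0 < w := ha0.trans hw.1
          simp only [Pi.zero_apply]; positivity
      _ = (b - a) + √2 * s * ∫ w in a..b, (1 + κ / w) := by
          rw [intervalIntegral.integral_add intervalIntegrable_const (hi'.const_mul _),
            intervalIntegral.integral_const_mul, intervalIntegral.integral_const]
          simp
      _ ≤ 1 / s + √2 * s * (4 * b) := by
          gcongr
          · linarith
          · exact integral_error_le ha0 hab hκ2
      _ = (1 + 4 * √2) / s := by
          rw [show √2 * s * (4 * b) = 4 * √2 * (s * b) by ring, hsb]; ring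
      _ ≤ 7 / s := by
          gcongr
          linarith [sqrt_two_le]
  have hc2 : ‖c‖ ≤ 3 / 2 / s := hcn.trans (by gcongr; exact sqrt_two_le)
  constructor
  · have hA := herr a le_rfl hab
    have hB := norm_integral_cusp_sub_log_le ha0 ham hmb hm1 hm3
    calc _ = ‖((∫ w in a..b, (thetaAt x w - 1)) -
          c * ∫ w in a..b, 1 / cuspParam h w ^ (1 / 2 : ℂ)) +
          c * ((∫ w in a..b, 1 / cuspParam h w ^ (1 / 2 : ℂ)) - (Real.log (b / m) : ℂ))‖ := by
          congr 1; rw [hlogm]; push_cast; ring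
      _ ≤ 7 / s + 3 / 2 / s * 2 := by
          refine (norm_add_le _ _).trans (add_le_add hA ?_)
          rw [norm_mul]
          gcongr
      _ ≤ 11 / s := by
          rw [div_mul_eq_mul_div, ← add_div]; gcongr; norm_num
  · intro w₀ haw hwb
    have hw0 : 0 < w₀ := ha0.trans_le haw
    have hA := herr w₀ haw hwb
    have hB : ‖∫ w in w₀..b, 1 / cuspParam h w ^ (1 / 2 : ℂ)‖ ≤ 1 + Real.log (b / m) := by
      refine (intervalIntegral.norm_integral_le_integral_norm hwb).trans ?_
      refine le_trans ?_ (integral_norm_cusp_le ha0 ham hmb hm1)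
      exact intervalIntegral.integral_mono_interval haw hwb le_rfl
        (Eventually.of_forall fun w => norm_nonneg _)
        (intervalIntegrable_of_continuousOn_Ioi (continuousOn_inv_cusp h) ha0 hb0).norm
    calc _ = ‖((∫ w in w₀..b, (thetaAt x w - 1)) -
          c * ∫ w in w₀..b, 1 / cuspParam h w ^ (1 / 2 : ℂ)) +
          c * (∫ w in w₀..b, 1 / cuspParam h w ^ (1 / 2 : ℂ))‖ := by
          congr 1; ring
      _ ≤ 7 / s + ‖c‖ * (1 + Real.log (b / m)) := by
          refine (norm_add_le _ _).trans (add_le_add hA ?_)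
          rw [norm_mul]
          gcongr
      _ = 7 / s + ‖c‖ + 1 / 2 * ‖c * (Real.log (Q / q) : ℂ)‖ := by
          rw [norm_mul, Complex.norm_real, Real.norm_of_nonneg hlog0, hlogm]; ring
      _ ≤ 1 / 2 * ‖c * (Real.log (Q / q) : ℂ)‖ + 11 / s := by
          have : 7 / s + 3 / 2 / s ≤ 11 / s := by
            rw [← add_div]; gcongr; norm_num
          linarith

/-! ### The smoothed series and its variation near a rational -/

lemma integrableOn_thetaAt_sub_one (x : ℝ) {w₀ : ℝ} (hw₀ : 0 < w₀) :
    IntegrableOn (fun w => thetaAt x w - 1) (Set.Ioi w₀) := by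
  have hg : IntegrableOn (fun w : ℝ => 2 / (1 - Real.exp (-Real.pi * w₀ ^ 2)) *
      Real.exp (-Real.pi * w ^ 2)) (Set.Ioi w₀) :=
    ((integrable_exp_neg_mul_sq Real.pi_pos).const_mul _).integrableOn
  refine Integrable.mono' hg ?_ ?_
  · refine ContinuousOn.aestronglyMeasurable ?_ measurableSet_Ioi
    exact ((continuousOn_thetaAt x).sub continuousOn_const).mono
      (Set.Ioi_subset_Ioi hw₀.le)
  · refine (ae_restrict_mem measurableSet_Ioi).mono fun w hw => ?_
    have hw : w₀ < w := hw
    have hw0 : 0 < w := hw₀.trans hw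
    have h := norm_jacobiTheta_sub_one_le (thetaAt_im_pos x hw0)
    have him : (2 * (x : ℂ) + Complex.I * (w : ℂ) ^ 2).im = w ^ 2 := by
      simp [← Complex.ofReal_pow]
    rw [him] at h
    refine h.trans ?_
    have h1 : Real.exp (-Real.pi * w₀ ^ 2) < 1 := by
      rw [Real.exp_lt_one_iff]
      have : 0 < Real.pi * w₀ ^ 2 := by positivity
      linarith
    have he : Real.exp (-Real.pi * w ^ 2) ≤ Real.exp (-Real.pi * w₀ ^ 2) := by
      have h3 : w₀ ^ 2 ≤ w ^ 2 := by gcongr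
      exact Real.exp_le_exp.mpr (mul_le_mul_of_nonpos_left h3 (neg_nonpos.mpr Real.pi_pos.le))
    exact mul_le_mul_of_nonneg_right
      (div_le_div_of_nonneg_left (by norm_num) (by linarith) (by linarith)) (Real.exp_pos _).le

/-- The smoothed Fourier series at scale `1 / w₀`. -/
def thetaTail (x w₀ : ℝ) : ℂ := ∫ w in Set.Ioi w₀, (thetaAt x w - 1)

lemma thetaTail_sub (x : ℝ) {a b : ℝ} (ha : 0 < a) (hab : a ≤ b) :
    thetaTail x a = (∫ w in a..b, (thetaAt x w - 1)) + thetaTail x b := by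
  have hb := ha.trans_le hab
  unfold thetaTail
  rw [intervalIntegral.integral_of_le hab, ← setIntegral_union
    (Set.Ioc_disjoint_Ioi le_rfl) measurableSet_Ioi
    ((integrableOn_thetaAt_sub_one x ha).mono_set Set.Ioc_subset_Ioi_self)
    (integrableOn_thetaAt_sub_one x hb), Set.Ioc_union_Ioi_eq_Ioi hab]

/-- Above height `1/q²` and within `1/q²` of the cusp, both the main term and the error are `O(√q)`.
The bound is stated on a disc so that Cauchy's estimate applies. -/
lemma norm_jacobiTheta_near_cusp_le (r : ℚ) {t w : ℝ} (hw : 1 / (r.den : ℝ) ≤ w)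
    (ht : |t - r| ≤ 1 / (r.den : ℝ) ^ 2) {τ : ℂ}
    (hτ : ‖τ - (2 * (t : ℂ) + Complex.I * (w : ℂ) ^ 2)‖ ≤ w ^ 2 / 2) :
    ‖jacobiTheta τ‖ ≤ 8 * √(r.den : ℝ) := by
  set q : ℝ := (r.den : ℝ) with hq
  have hq1 : 1 ≤ q := by rw [hq]; exact_mod_cast r.den_pos
  have hq0 : 0 < q := by linarith
  have hw0 : 0 < w := lt_of_lt_of_le (by positivity) hw
  have hqw : 1 / q ^ 2 ≤ w ^ 2 := by
    rw [← one_div_pow]; gcongr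
  set τ₀ : ℂ := 2 * (t : ℂ) + Complex.I * (w : ℂ) ^ 2 with hτ₀
  set z : ℂ := -Complex.I * (τ - 2 * (r : ℂ)) with hz
  have hτz : 2 * (r : ℂ) + Complex.I * z = τ := by
    rw [hz, ← mul_assoc, mul_neg, Complex.I_mul_I]; ring
  have him : τ₀.im = w ^ 2 := by rw [hτ₀]; simp [← Complex.ofReal_pow]
  have hre : w ^ 2 / 2 ≤ z.re := by
    have h1 : z.re = τ.im := by rw [hz]; simp
    have h2 := (Complex.abs_im_le_norm (τ - τ₀)).trans hτ
    rw [Complex.sub_im, him] at h2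
    rw [h1]
    have := (abs_le.mp h2).1
    linarith
  have hre0 : 0 < z.re := lt_of_lt_of_le (by positivity) hre
  have hn1 : w ^ 2 / 2 ≤ ‖z‖ := hre.trans (Complex.re_le_norm z)
  have hn2 : ‖z‖ ≤ (2 * w) ^ 2 := by
    have e1 : ‖z‖ = ‖τ - 2 * (r : ℂ)‖ := by rw [hz, norm_mul]; simp
    have e2 : τ - 2 * (r : ℂ) = (τ - τ₀) + (((2 * (t - r) : ℝ) : ℂ) +
        Complex.I * ((w ^ 2 : ℝ) : ℂ)) := by
      rw [hτ₀]; push_cast; ring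
    rw [e1, e2]
    refine (norm_add_le _ _).trans ?_
    have e3 : ‖((2 * (t - r) : ℝ) : ℂ) + Complex.I * ((w ^ 2 : ℝ) : ℂ)‖ ≤ 2 * w ^ 2 + w ^ 2 := by
      refine (norm_add_le _ _).trans (add_le_add ?_ ?_)
      · rw [Complex.norm_real, Real.norm_eq_abs, abs_mul, abs_two]; linarith
      · rw [norm_mul, Complex.norm_I, one_mul, Complex.norm_real, Real.norm_of_nonneg (by positivity)]
    nlinarith
  have hsq0 : 0 < √q := Real.sqrt_pos.mpr hq0
  have hs1 : w / √2 ≤ √‖z‖ := by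
    refine Real.le_sqrt_of_sq_le ?_
    rw [div_pow, Real.sq_sqrt (by norm_num)]; exact hn1
  have hs2 : √‖z‖ ≤ 2 * w := Real.sqrt_le_iff.mpr ⟨by positivity, hn2⟩
  have hs3 : w / √2 ≤ √z.re := by
    refine Real.le_sqrt_of_sq_le ?_
    rw [div_pow, Real.sq_sqrt (by norm_num)]; exact hre
  have h22 : √2 * √2 = 2 := Real.mul_self_sqrt (by norm_num)
  have hmain := norm_jacobiTheta_sub_main_le r hre0
  rw [hτz] at hmain
  have hM : ‖theta r / (√q : ℂ) / z ^ (1 / 2 : ℂ)‖ ≤ 2 * √q := by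
    rw [norm_div, norm_div, norm_cpow_half, Complex.norm_real, Real.norm_of_nonneg hsq0.le]
    calc _ ≤ √2 / √q / (w / √2) := by gcongr; exact norm_theta_le r
      _ = 2 * (1 / w) / √q := by field_simp; linarith
      _ ≤ 2 * q / √q := by
          gcongr
          rw [div_le_iff₀ hw0]
          rw [div_le_iff₀ hq0] at hw
          linarith
      _ = 2 * √q := by
          rw [mul_div_assoc, Real.div_sqrt]
  have hE : √2 * √q * √‖z‖ / √z.re ≤ 4 * √q := by
    calc _ ≤ √2 * √q * (2 * w) / (w / √2) := by gcongr
      _ = 2 * (√2 * √2) * √q := by field_simp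
      _ = 4 * √q := by rw [h22]; ring
  calc ‖jacobiTheta τ‖ = ‖(jacobiTheta τ - theta r / (√q : ℂ) / z ^ (1 / 2 : ℂ)) +
        theta r / (√q : ℂ) / z ^ (1 / 2 : ℂ)‖ := by congr 1; ring
    _ ≤ 4 * √q + 2 * √q := (norm_add_le _ _).trans (add_le_add (hmain.trans hE) hM)
    _ ≤ 8 * √q := by linarith

/-- Cauchy's estimate on circles of radius `w²/2` bounds `θ'` by `16√q/w²` along the segment; the
argument moves by `2(x - y)`, which doubles the constant. -/
lemma norm_thetaAt_sub_le (r : ℚ) {x y w : ℝ} (hw : 1 / (r.den : ℝ) ≤ w)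
    (hx : |x - r| ≤ 1 / (r.den : ℝ) ^ 2) (hy : |y - r| ≤ 1 / (r.den : ℝ) ^ 2) :
    ‖thetaAt x w - thetaAt y w‖ ≤ 32 * √(r.den : ℝ) / w ^ 2 * |x - y| := by
  have hq0 : (0 : ℝ) < r.den := by exact_mod_cast r.den_pos
  have hw0 : 0 < w := lt_of_lt_of_le (by positivity) hw
  set f : ℝ → ℂ := fun t => 2 * (t : ℂ) + Complex.I * (w : ℂ) ^ 2 with hf
  have hseg : ∀ τ ∈ segment ℝ (f y) (f x), ∃ t : ℝ, |t - r| ≤ 1 / (r.den : ℝ) ^ 2 ∧ τ = f t := by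
    rintro τ ⟨a, b, ha, hb, hab, rfl⟩
    refine ⟨a * y + b * x, ?_, ?_⟩
    · have : a * y + b * x - r = a * (y - r) + b * (x - r) := by
        linear_combination (r : ℝ) * hab
      rw [this]
      refine (abs_add_le _ _).trans ?_
      rw [abs_mul, abs_mul, abs_of_nonneg ha, abs_of_nonneg hb]
      calc _ ≤ a * (1 / (r.den : ℝ) ^ 2) + b * (1 / (r.den : ℝ) ^ 2) := by gcongr
        _ = _ := by rw [← add_mul, hab, one_mul]
    · simp only [hf, Complex.real_smul]
      push_cast
      have : (a : ℂ) + b = 1 := by exact_mod_cast hab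
      linear_combination (Complex.I * (w : ℂ) ^ 2) * this
  have hdiff : ∀ τ : ℂ, 0 < τ.im → DifferentiableAt ℂ jacobiTheta τ :=
    fun τ hτ => differentiableAt_jacobiTheta hτ
  have h := Convex.norm_image_sub_le_of_norm_deriv_le (𝕜 := ℂ) (f := jacobiTheta)
    (C := 16 * √(r.den : ℝ) / w ^ 2) (s := segment ℝ (f y) (f x)) (x := f y) (y := f x)
    (fun τ hτ => by
      obtain ⟨t, -, rfl⟩ := hseg τ hτ
      exact hdiff _ (thetaAt_im_pos t hw0))
    (fun τ hτ => by
      obtain ⟨t, ht, rfl⟩ := hseg τ hτ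
      have hR : 0 < w ^ 2 / 2 := by positivity
      have him : (f t).im = w ^ 2 := by simp [hf, ← Complex.ofReal_pow]
      have hd : DiffContOnCl ℂ jacobiTheta (Metric.ball (f t) (w ^ 2 / 2)) := by
        apply DifferentiableOn.diffContOnCl
        rw [closure_ball _ hR.ne']
        intro τ hτ
        refine (hdiff τ ?_).differentiableWithinAt
        rw [Metric.mem_closedBall, dist_eq_norm] at hτ
        have h2 := (Complex.abs_im_le_norm (τ - f t)).trans hτ
        rw [Complex.sub_im, him] at h2
        have := (abs_le.mp h2).1
        linarith
      have := Complex.norm_deriv_le_of_forall_mem_sphere_norm_le hR hd (C := 8 * √(r.den : ℝ))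
        (fun τ hτ => norm_jacobiTheta_near_cusp_le r hw ht (by
          rw [mem_sphere_iff_norm] at hτ; exact hτ.le))
      refine this.trans (le_of_eq ?_)
      field_simp; norm_num)
    (convex_segment _ _) (left_mem_segment _ _ _) (right_mem_segment _ _ _)
  refine h.trans (le_of_eq ?_)
  have : f x - f y = ((2 * (x - y) : ℝ) : ℂ) := by simp only [hf]; push_cast; ring
  rw [this, Complex.norm_real, Real.norm_eq_abs, abs_mul, abs_two]
  ring

lemma integral_inv_sq_Ioi {c : ℝ} (hc : 0 < c) :
    IntegrableOn (fun w : ℝ => 1 / w ^ 2) (Set.Ioi c) ∧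
      ∫ w in Set.Ioi c, 1 / w ^ 2 = 1 / c := by
  have h : Set.EqOn (fun w : ℝ => w ^ (-2 : ℝ)) (fun w : ℝ => 1 / w ^ 2) (Set.Ioi c) := by
    intro w hw
    have hw : 0 < w := hc.trans hw
    simp only
    rw [Real.rpow_neg hw.le, one_div]; norm_cast
  constructor
  · exact (integrableOn_Ioi_rpow_of_lt (by norm_num) hc).congr_fun h measurableSet_Ioi
  · rw [← setIntegral_congr_fun measurableSet_Ioi h, integral_Ioi_rpow_of_lt (by norm_num) hc]
    norm_num
    rw [Real.rpow_neg_one]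

/-- The integral of `1/w²` beyond `1/q` is `q`, and `|x - y| ≤ 2/q²`, so the variation is `O(√q ·
q⁻² · q)`. This allows comparison of different points of one cylinder. -/
lemma norm_thetaTail_sub_le (r : ℚ) {x y : ℝ}
    (hx : |x - r| ≤ 1 / (r.den : ℝ) ^ 2) (hy : |y - r| ≤ 1 / (r.den : ℝ) ^ 2) :
    ‖thetaTail x (1 / r.den) - thetaTail y (1 / r.den)‖ ≤ 64 / √(r.den : ℝ) := by
  set q : ℝ := (r.den : ℝ) with hq
  have hq0 : (0 : ℝ) < q := by rw [hq]; exact_mod_cast r.den_pos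
  have hc : 0 < 1 / q := by positivity
  unfold thetaTail
  rw [← integral_sub (integrableOn_thetaAt_sub_one x hc) (integrableOn_thetaAt_sub_one y hc)]
  obtain ⟨hi, hI⟩ := integral_inv_sq_Ioi hc
  have hxy : |x - y| ≤ 2 / q ^ 2 := by
    have : x - y = (x - r) - (y - r) := by ring
    rw [this]
    refine (abs_sub _ _).trans ?_
    have : 2 / q ^ 2 = 1 / q ^ 2 + 1 / q ^ 2 := by ring
    linarith
  calc _ ≤ ∫ w in Set.Ioi (1 / q), 32 * √q * |x - y| * (1 / w ^ 2) := by
        refine norm_integral_le_of_norm_le (hi.const_mul _) ?_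
        refine (ae_restrict_mem measurableSet_Ioi).mono fun w hw => ?_
        have hw : 1 / q < w := hw
        have := norm_thetaAt_sub_le r hw.le hx hy
        rw [sub_sub_sub_cancel_right]
        refine this.trans (le_of_eq ?_)
        ring
    _ = 32 * √q * |x - y| * q := by
        rw [integral_const_mul, hI]; field_simp
    _ ≤ 32 * √q * (2 / q ^ 2) * q := by gcongr
    _ = 64 / √q := by
        have : √q ^ 2 = q := Real.sq_sqrt hq0.le
        have h0 := Real.sqrt_pos.mpr hq0
        field_simp
        linear_combination 64 * this

/-! ### Weyl sums -/

lemma e_eq_one_iff (t : ℝ) : e t = 1 ↔ ∃ n : ℤ, t = n := by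
  constructor
  · intro h
    obtain ⟨n, hn⟩ := Complex.exp_eq_one_iff.mp h
    refine ⟨n, ?_⟩
    have h2 : (2 * Real.pi * Complex.I : ℂ) ≠ 0 := Complex.two_pi_I_ne_zero
    have : (2 * Real.pi * Complex.I : ℂ) * t = (2 * Real.pi * Complex.I : ℂ) * n := by
      rw [hn]; ring
    exact_mod_cast mul_left_cancel₀ h2 this
  · rintro ⟨n, rfl⟩; exact e_int n

lemma e_nat_mul (n : ℕ) (t : ℝ) : e (n * t) = e t ^ n := by
  unfold e; rw [← Complex.exp_nat_mul]; congr 1; push_cast; ring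

lemma norm_geom_e_le {t : ℝ} (ht : e t ≠ 1) (N : ℕ) :
    ‖∑ n ∈ Finset.range N, e (n * t)‖ ≤ 2 / ‖e t - 1‖ := by
  simp_rw [e_nat_mul]
  rw [geom_sum_eq ht, norm_div]
  gcongr
  refine (norm_sub_le _ _).trans ?_
  rw [norm_pow, norm_e]; norm_num

/-- Weyl sums of `n²x`. -/
def weylSum (x : ℝ) (N : ℕ) : ℂ := ∑ n ∈ Finset.range N, e ((n : ℝ) ^ 2 * x)

lemma norm_weylSum_le (x : ℝ) (N : ℕ) : ‖weylSum x N‖ ≤ N := by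
  refine (norm_sum_le _ _).trans ?_
  simp [norm_e]

lemma norm_weylSum_sub_shift_le (x : ℝ) (N h : ℕ) :
    ‖weylSum x N - ∑ n ∈ Finset.range N, e (((n + h : ℕ) : ℝ) ^ 2 * x)‖ ≤ 2 * h := by
  have h1 : ∑ n ∈ Finset.range N, e (((n + h : ℕ) : ℝ) ^ 2 * x) =
      weylSum x (N + h) - weylSum x h := by
    unfold weylSum
    rw [add_comm N h, Finset.sum_range_add, add_sub_cancel_left]
    refine Finset.sum_congr rfl fun n _ => ?_
    rw [add_comm]
  have h2 : weylSum x (N + h) = weylSum x N +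
      ∑ n ∈ Finset.range h, e (((N + n : ℕ) : ℝ) ^ 2 * x) := by
    unfold weylSum; rw [Finset.sum_range_add]
  rw [h1, h2]
  have h3 : ‖∑ n ∈ Finset.range h, e (((N + n : ℕ) : ℝ) ^ 2 * x)‖ ≤ h := by
    refine (norm_sum_le _ _).trans ?_
    simp [norm_e]
  calc _ = ‖weylSum x h - ∑ n ∈ Finset.range h, e (((N + n : ℕ) : ℝ) ^ 2 * x)‖ := by
        congr 1; ring
    _ ≤ _ := (norm_sub_le _ _).trans (by linarith [norm_weylSum_le x h])

/-- Expanding the square, the diagonal gives `HN`. Each off-diagonal pair gives a geometric sum of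
ratio `e(2(h - k)x) ≠ 1`, bounded independently of `N`. -/
lemma exists_shift_correlation_bound {x : ℝ} (hx : Irrational x) (H : ℕ) :
    ∃ K : ℝ, 0 ≤ K ∧ ∀ N : ℕ, ∑ n ∈ Finset.range N,
      ‖∑ h ∈ Finset.range H, e (((n + h : ℕ) : ℝ) ^ 2 * x)‖ ^ 2 ≤ H * N + K := by
  set t : ℕ → ℕ → ℝ := fun h k => 2 * ((h : ℝ) - k) * x with ht
  -- The diagonal summands are `2 / 0 = 0`.
  refine ⟨∑ h ∈ Finset.range H, ∑ k ∈ Finset.range H, 2 / ‖e (t h k) - 1‖,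
    by positivity, fun N => ?_⟩
  have hterm : ∀ n h k : ℕ, e (((n + h : ℕ) : ℝ) ^ 2 * x) *
      (starRingEnd ℂ) (e (((n + k : ℕ) : ℝ) ^ 2 * x)) =
      e (((h : ℝ) ^ 2 - (k : ℝ) ^ 2) * x) * e (n * t h k) := by
    intro n h k
    rw [e_conj, ← e_add, ← e_add, ht]
    congr 1; push_cast; ring
  have hsum : ((∑ n ∈ Finset.range N,
      ‖∑ h ∈ Finset.range H, e (((n + h : ℕ) : ℝ) ^ 2 * x)‖ ^ 2 : ℝ) : ℂ) =
      ∑ h ∈ Finset.range H, ∑ k ∈ Finset.range H, e (((h : ℝ) ^ 2 - (k : ℝ) ^ 2) * x) *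
        ∑ n ∈ Finset.range N, e (n * t h k) := by
    push_cast
    calc _ = ∑ n ∈ Finset.range N, ∑ h ∈ Finset.range H, ∑ k ∈ Finset.range H,
          e (((h : ℝ) ^ 2 - (k : ℝ) ^ 2) * x) * e (n * t h k) := by
          refine Finset.sum_congr rfl fun n _ => ?_
          rw [← Complex.mul_conj', map_sum, Finset.sum_mul_sum]
          refine Finset.sum_congr rfl fun h _ => Finset.sum_congr rfl fun k _ => ?_
          rw [← hterm]; push_cast; rfl
      _ = _ := by
          rw [Finset.sum_comm]
          refine Finset.sum_congr rfl fun h _ => ?_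
          rw [Finset.sum_comm]
          refine Finset.sum_congr rfl fun k _ => ?_
          rw [Finset.mul_sum]
  have hpos : 0 ≤ ∑ n ∈ Finset.range N,
      ‖∑ h ∈ Finset.range H, e (((n + h : ℕ) : ℝ) ^ 2 * x)‖ ^ 2 := by positivity
  have hnorm := congrArg norm hsum
  rw [Complex.norm_real, Real.norm_of_nonneg hpos] at hnorm
  rw [hnorm]
  have hb : ∀ h k : ℕ, ‖e (((h : ℝ) ^ 2 - (k : ℝ) ^ 2) * x) *
      ∑ n ∈ Finset.range N, e (n * t h k)‖ ≤
      (if h = k then (N : ℝ) else 0) + 2 / ‖e (t h k) - 1‖ := by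
    intro h k
    rw [norm_mul, norm_e, one_mul]
    split_ifs with hk
    · refine (norm_sum_le _ _).trans ?_
      have : 0 ≤ 2 / ‖e (t h k) - 1‖ := by positivity
      simp only [norm_e, Finset.sum_const, Finset.card_range, nsmul_eq_mul, mul_one]
      linarith
    · rw [zero_add]
      refine norm_geom_e_le (fun h1 => ?_) N
      obtain ⟨m, hm⟩ := (e_eq_one_iff _).mp h1
      have hd : (2 * ((h : ℤ) - k)) ≠ 0 := by omega
      refine (hx.intCast_mul hd) ⟨m, ?_⟩
      rw [Rat.cast_intCast, ← hm, ht]; push_cast; ring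
  calc _ ≤ ∑ h ∈ Finset.range H, ∑ k ∈ Finset.range H,
        ((if h = k then (N : ℝ) else 0) + 2 / ‖e (t h k) - 1‖) :=
        (norm_sum_le _ _).trans (Finset.sum_le_sum fun h _ =>
          (norm_sum_le _ _).trans (Finset.sum_le_sum fun k _ => hb h k))
    _ ≤ _ := by
        simp_rw [Finset.sum_add_distrib]
        gcongr
        calc _ ≤ ∑ h ∈ Finset.range H, (N : ℝ) := by
              refine Finset.sum_le_sum fun h _ => ?_
              rw [Finset.sum_ite_eq]
              split_ifs
              simp
          _ = _ := by simp

/-- Weyl's theorem for `n²x`, in a form with an additive constant. -/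
lemma exists_weylSum_bound {x : ℝ} (hx : Irrational x) {η : ℝ} (hη : 0 < η) :
    ∃ D : ℝ, 0 ≤ D ∧ ∀ N : ℕ, ‖weylSum x N‖ ≤ η * N + D := by
  -- Van der Corput averaging over `H` shifts saves a factor `√H`, so `H > 1/η²` suffices.
  obtain ⟨H, hH⟩ := exists_nat_gt (max 1 (1 / η ^ 2))
  have hH1 : (1 : ℝ) < H := (le_max_left _ _).trans_lt hH
  have hH0 : (0 : ℝ) < H := by linarith
  have hHη : 1 ≤ η ^ 2 * H := by
    have := ((le_max_right _ _).trans_lt hH).le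
    rwa [div_le_iff₀' (by positivity)] at this
  obtain ⟨K, hK0, hK⟩ := exists_shift_correlation_bound hx H
  refine ⟨K + 2 * H, by positivity, fun N => ?_⟩
  set b : ℕ → ℂ := fun n => ∑ h ∈ Finset.range H, e (((n + h : ℕ) : ℝ) ^ 2 * x) with hb
  have h1 : ‖(H : ℂ) * weylSum x N - ∑ n ∈ Finset.range N, b n‖ ≤ H * (2 * H) := by
    have : (H : ℂ) * weylSum x N - ∑ n ∈ Finset.range N, b n =
        ∑ h ∈ Finset.range H,
          (weylSum x N - ∑ n ∈ Finset.range N, e (((n + h : ℕ) : ℝ) ^ 2 * x)) := by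
      rw [hb, Finset.sum_sub_distrib, Finset.sum_comm]; simp
    rw [this]
    refine (norm_sum_le _ _).trans ?_
    calc _ ≤ ∑ h ∈ Finset.range H, (2 * H : ℝ) := by
          refine Finset.sum_le_sum fun h hh => (norm_weylSum_sub_shift_le x N h).trans ?_
          have : (h : ℝ) ≤ H := by exact_mod_cast (Finset.mem_range.mp hh).le
          linarith
      _ = _ := by simp
  have h2 : ‖∑ n ∈ Finset.range N, b n‖ ^ 2 ≤ N * (H * N + K) := by
    calc _ ≤ (∑ n ∈ Finset.range N, ‖b n‖) ^ 2 := by gcongr; exact norm_sum_le _ _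
      _ ≤ (Finset.range N).card * ∑ n ∈ Finset.range N, ‖b n‖ ^ 2 :=
          sq_sum_le_card_mul_sum_sq
      _ ≤ _ := by rw [Finset.card_range]; gcongr; exact hK N
  have h3 : ‖∑ n ∈ Finset.range N, b n‖ ≤ H * (η * N + K) := by
    refine abs_le_of_sq_le_sq' (h2.trans ?_) (by positivity) |>.2
    have hN : (0 : ℝ) ≤ N := Nat.cast_nonneg N
    have e0 : 1 ≤ η * H := by
      have : (1 : ℝ) ^ 2 ≤ (η * H) ^ 2 := by nlinarith
      exact (abs_le_of_sq_le_sq' this (by positivity)).2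
    have e1 : (N : ℝ) * (H * N) ≤ (η * N * H) ^ 2 := by
      have : 0 ≤ (H : ℝ) * N * N := by positivity
      nlinarith
    have e2 : (N : ℝ) * K ≤ (η * H * H) * (N * K) := by
      have : 0 ≤ (N : ℝ) * K := by positivity
      have : 1 ≤ η * H * H := by nlinarith
      nlinarith
    have e3 : 0 ≤ (η * H * H) * (N * K) := by positivity
    have e4 : 0 ≤ (H * K) ^ 2 := by positivity
    nlinarith
  have h4 : H * ‖weylSum x N‖ ≤ H * (η * N + (K + 2 * H)) := by
    calc H * ‖weylSum x N‖ = ‖((H : ℂ) * weylSum x N - ∑ n ∈ Finset.range N, b n) +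
          ∑ n ∈ Finset.range N, b n‖ := by
          rw [sub_add_cancel, norm_mul, Complex.norm_natCast]
      _ ≤ H * (2 * H) + H * (η * N + K) := (norm_add_le _ _).trans (add_le_add h1 h3)
      _ = _ := by ring
  exact le_of_mul_le_mul_left h4 hH0

/-! ### Partial sums against the smoothed series -/

lemma norm_sum_mul_antitone_le {a : ℕ → ℂ} {f : ℕ → ℝ} {η D : ℝ}
    (hS : ∀ n, ‖∑ i ∈ Finset.range n, a i‖ ≤ η * n + D) (M : ℕ)
    (hf : ∀ n, M ≤ n → f (n + 1) ≤ f n)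
    (hf0 : ∀ n, M ≤ n → 0 ≤ f n) (L : ℕ) (hL : M ≤ L) :
    ‖∑ n ∈ Finset.Ico M L, a n * f n‖ ≤
      η * (∑ n ∈ Finset.Ico M L, f n + 2 * (M * f M)) + 2 * D * f M := by
  set S : ℕ → ℂ := fun n => ∑ i ∈ Finset.range n, a i with hSdef
  -- With the boundary terms of Abel summation included, the increment is exactly `S(L+1)(f L -
  -- f(L+1))`, and the bounds `ηn + D` are summed back by parts.
  have key : ‖∑ n ∈ Finset.Ico M L, a n * f n - S L * f L + S M * f M‖ ≤
      η * (∑ n ∈ Finset.Ico M L, f n + M * f M - L * f L) + D * (f M - f L) := by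
    induction L, hL using Nat.le_induction with
    | base => simp
    | succ L hL ih =>
      have hSL : S (L + 1) = S L + a L := by
        simp only [hSdef]; exact Finset.sum_range_succ _ _
      rw [Finset.sum_Ico_succ_top hL, Finset.sum_Ico_succ_top hL]
      have hstep : ‖S (L + 1) * ((f L - f (L + 1) : ℝ) : ℂ)‖ ≤
          (η * (L + 1 : ℕ) + D) * (f L - f (L + 1)) := by
        rw [norm_mul, Complex.norm_real, Real.norm_of_nonneg (by linarith [hf L hL])]
        exact mul_le_mul_of_nonneg_right (hS _) (by linarith [hf L hL])
      calc _ = ‖(∑ n ∈ Finset.Ico M L, a n * f n - S L * f L + S M * f M) +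
            S (L + 1) * ((f L - f (L + 1) : ℝ) : ℂ)‖ := by
            congr 1; rw [hSL]; push_cast; ring
        _ ≤ _ := (norm_add_le _ _).trans (add_le_add ih hstep)
        _ = _ := by push_cast; ring
  have h1 : ‖S L * f L‖ ≤ (η * L + D) * f L := by
    rw [norm_mul, Complex.norm_real, Real.norm_of_nonneg (hf0 L hL)]
    exact mul_le_mul_of_nonneg_right (hS _) (hf0 L hL)
  have h2 : ‖S M * f M‖ ≤ (η * M + D) * f M := by
    rw [norm_mul, Complex.norm_real, Real.norm_of_nonneg (hf0 M le_rfl)]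
    exact mul_le_mul_of_nonneg_right (hS _) (hf0 M le_rfl)
  calc _ = ‖(∑ n ∈ Finset.Ico M L, a n * f n - S L * f L + S M * f M) + S L * f L - S M * f M‖ := by
        congr 1; ring
    _ ≤ _ := (norm_sub_le _ _).trans (add_le_add ((norm_add_le _ _).trans (add_le_add key h1)) h2)
    _ = _ := by ring

/-- The Gaussian weight attached to `n` in the smoothed series. -/
def tailWeight (w₀ : ℝ) (n : ℕ) : ℝ := ∫ w in Set.Ioi w₀, 2 * Real.exp (-(Real.pi * n ^ 2) * w ^ 2)

/-- The complementary weight. -/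
def headWeight (w₀ : ℝ) (n : ℕ) : ℝ := ∫ w in Set.Ioc 0 w₀, 2 * Real.exp (-(Real.pi * n ^ 2) * w ^ 2)

lemma integrable_weight {n : ℕ} (hn : 1 ≤ n) :
    Integrable fun w : ℝ => 2 * Real.exp (-(Real.pi * (n : ℝ) ^ 2) * w ^ 2) := by
  have : (0 : ℝ) < n := by exact_mod_cast hn
  exact (integrable_exp_neg_mul_sq (by positivity)).const_mul 2

/-- The half-line Gaussian integral produces the coefficient `1/n` of the series; this is why theta
is integrated in `w` at height `w²`. -/
lemma headWeight_add_tailWeight {w₀ : ℝ} (hw : 0 < w₀) {n : ℕ} (hn : 1 ≤ n) :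
    headWeight w₀ n + tailWeight w₀ n = 1 / n := by
  have hn0 : (0 : ℝ) < n := by exact_mod_cast hn
  unfold headWeight tailWeight
  rw [← setIntegral_union (Set.Ioc_disjoint_Ioi le_rfl) measurableSet_Ioi
    (integrable_weight hn).integrableOn (integrable_weight hn).integrableOn,
    Set.Ioc_union_Ioi_eq_Ioi hw.le, integral_const_mul, integral_gaussian_Ioi]
  have : Real.pi / (Real.pi * (n : ℝ) ^ 2) = (1 / n) ^ 2 := by field_simp
  rw [this, Real.sqrt_sq (by positivity)]
  ring

lemma weight_antitone {m n : ℕ} (h : m ≤ n) (w : ℝ) :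
    2 * Real.exp (-(Real.pi * (n : ℝ) ^ 2) * w ^ 2) ≤
      2 * Real.exp (-(Real.pi * (m : ℝ) ^ 2) * w ^ 2) := by
  have : (m : ℝ) ≤ n := by exact_mod_cast h
  gcongr

lemma tailWeight_succ_le (w₀ : ℝ) {n : ℕ} (hn : 1 ≤ n) :
    tailWeight w₀ (n + 1) ≤ tailWeight w₀ n :=
  setIntegral_mono (integrable_weight (by omega)).integrableOn (integrable_weight hn).integrableOn
    (weight_antitone n.le_succ)

lemma headWeight_succ_le (w₀ : ℝ) {n : ℕ} (hn : 1 ≤ n) :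
    headWeight w₀ (n + 1) ≤ headWeight w₀ n :=
  setIntegral_mono (integrable_weight (by omega)).integrableOn (integrable_weight hn).integrableOn
    (weight_antitone n.le_succ)

lemma tailWeight_nonneg (w₀ : ℝ) (n : ℕ) : 0 ≤ tailWeight w₀ n :=
  integral_nonneg fun _ => by positivity

lemma headWeight_nonneg (w₀ : ℝ) (n : ℕ) : 0 ≤ headWeight w₀ n :=
  integral_nonneg fun _ => by positivity

lemma headWeight_le {w₀ : ℝ} (hw : 0 < w₀) {n : ℕ} (hn : 1 ≤ n) : headWeight w₀ n ≤ 2 * w₀ := by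
  unfold headWeight
  calc _ ≤ ∫ w in Set.Ioc 0 w₀, (2 : ℝ) := by
        refine setIntegral_mono (integrable_weight hn).integrableOn
          (integrableOn_const (by simp)) fun w => ?_
        have : Real.exp (-(Real.pi * (n : ℝ) ^ 2) * w ^ 2) ≤ 1 := by
          rw [Real.exp_le_one_iff]
          have : 0 ≤ Real.pi * (n : ℝ) ^ 2 * w ^ 2 := by positivity
          linarith
        linarith
    _ = 2 * w₀ := by simp [hw.le, mul_comm]

/-- On the range of integration `w² ≥ w₀ w`, which reduces the Gaussian to an exponential. -/
lemma tailWeight_le {w₀ : ℝ} (hw : 0 < w₀) {n : ℕ} (hn : 1 ≤ n) :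
    tailWeight w₀ n ≤ 1 / w₀ * ((n : ℝ) ^ 2)⁻¹ := by
  have hn0 : (0 : ℝ) < n := by exact_mod_cast hn
  set c : ℝ := Real.pi * n ^ 2 * w₀ with hc
  have hc0 : 0 < c := by positivity
  unfold tailWeight
  have hi : IntegrableOn (fun w : ℝ => Real.exp (-c * w)) (Set.Ioi w₀) :=
    integrableOn_exp_mul_Ioi (by linarith) w₀
  calc _ ≤ ∫ w in Set.Ioi w₀, 2 * Real.exp (-c * w) := by
        refine setIntegral_mono_on (integrable_weight hn).integrableOn (hi.const_mul 2)
          measurableSet_Ioi fun w hw' => ?_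
        have hw' : w₀ < w := hw'
        have : c * w ≤ Real.pi * n ^ 2 * w ^ 2 := by
          have : Real.pi * n ^ 2 * w * w₀ ≤ Real.pi * n ^ 2 * w * w := by
            have : 0 < w := hw.trans hw'
            gcongr
          rw [hc]; linarith
        gcongr 2 * ?_
        apply Real.exp_le_exp.mpr; linarith
    _ = 2 * (Real.exp (-c * w₀) / c) := by
        rw [integral_const_mul, integral_exp_mul_Ioi (by linarith)]
        congr 1; rw [neg_div_neg_eq]
    _ ≤ 2 * (1 / c) := by
        gcongr
        rw [Real.exp_le_one_iff]; nlinarith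
    _ ≤ _ := by
        rw [hc]
        have hpi := Real.pi_gt_three
        have : 2 * (1 / (Real.pi * n ^ 2 * w₀)) = 2 / Real.pi * (1 / w₀ * ((n : ℝ) ^ 2)⁻¹) := by
          field_simp
        rw [this]
        have h2 : 2 / Real.pi ≤ 1 := by rw [div_le_one (by linarith)]; linarith
        have : 0 ≤ 1 / w₀ * ((n : ℝ) ^ 2)⁻¹ := by positivity
        nlinarith

lemma hasSum_thetaTail (x : ℝ) {w₀ : ℝ} (hw : 0 < w₀) :
    HasSum (fun n : ℕ => e (((n + 1 : ℕ) : ℝ) ^ 2 * x) * (tailWeight w₀ (n + 1) : ℂ))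
      (thetaTail x w₀) := by
  set Fn : ℕ → ℝ → ℂ := fun n w => e (((n + 1 : ℕ) : ℝ) ^ 2 * x) *
    ((2 * Real.exp (-(Real.pi * ((n + 1 : ℕ) : ℝ) ^ 2) * w ^ 2) : ℝ) : ℂ) with hFn
  have hint : ∀ n, Integrable (Fn n) (volume.restrict (Set.Ioi w₀)) := fun n =>
    ((integrable_weight (Nat.succ_le_succ n.zero_le)).ofReal.const_mul _).integrableOn
  have hnorm : ∀ n, ∫ w in Set.Ioi w₀, ‖Fn n w‖ = tailWeight w₀ (n + 1) := by
    intro n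
    unfold tailWeight
    refine integral_congr_ae (Eventually.of_forall fun w => ?_)
    simp only [hFn]
    rw [norm_mul, norm_e, one_mul, Complex.norm_real, Real.norm_of_nonneg (by positivity)]
  have hsum : Summable fun n => ∫ w in Set.Ioi w₀, ‖Fn n w‖ := by
    simp_rw [hnorm]
    refine Summable.of_nonneg_of_le (fun n => tailWeight_nonneg _ _)
      (fun n => tailWeight_le hw (Nat.succ_le_succ n.zero_le)) ?_
    have : Summable fun n : ℕ => ((n : ℝ) ^ 2)⁻¹ := Real.summable_nat_pow_inv.mpr (by norm_num)
    exact ((summable_nat_add_iff 1).mpr this).mul_left _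
  have h := hasSum_integral_of_summable_integral_norm hint hsum
  have e1 : ∫ w in Set.Ioi w₀, ∑' n, Fn n w = thetaTail x w₀ := by
    refine setIntegral_congr_fun measurableSet_Ioi fun w hw' => ?_
    have hw0 : 0 < w := hw.trans hw'
    have := (hasSum_nat_jacobiTheta (thetaAt_im_pos x hw0)).mul_left 2
    rw [mul_div_cancel₀ _ (two_ne_zero)] at this
    simp only [thetaAt]
    rw [← this.tsum_eq]
    refine tsum_congr fun n => ?_
    simp only [hFn, e]
    push_cast
    rw [mul_left_comm, ← Complex.exp_add]
    congr 2
    linear_combination (-(Real.pi : ℂ) * (n + 1) ^ 2 * (w : ℂ) ^ 2) * Complex.I_sq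
  rw [e1] at h
  have e2 : (fun n : ℕ => e (((n + 1 : ℕ) : ℝ) ^ 2 * x) * (tailWeight w₀ (n + 1) : ℂ)) =
      fun n => ∫ w in Set.Ioi w₀, Fn n w := by
    funext n
    simp only [hFn, tailWeight]
    rw [← integral_complex_ofReal, ← integral_const_mul]
  rw [e2]
  exact h

/-- The difference is the head weights on `n ≤ N` minus the tail weights on `n > N`. Both families
are decreasing, with total mass `O(1)` and maximum `O(1/N)`, so Abel summation yields `O(η + D/N)`.
-/
lemma partialSum_sub_thetaTail_le {x η D : ℝ} (hη : 0 ≤ η) (hD : 0 ≤ D)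
    (hS : ∀ n, ‖weylSum x n‖ ≤ η * n + D) {N : ℕ} (hN : 1 ≤ N) :
    ‖partialSum x N - thetaTail x (1 / N)‖ ≤ 9 * η + 6 * D / N := by
  have hN0 : (0 : ℝ) < N := by exact_mod_cast hN
  set w₀ : ℝ := 1 / N with hw₀
  have hw : 0 < w₀ := by positivity
  set a : ℕ → ℂ := fun n => e ((n : ℝ) ^ 2 * x) with ha
  have hpart : partialSum x N = ∑ n ∈ Finset.Ico 1 (N + 1), a n * headWeight w₀ n +
      ∑ n ∈ Finset.Ico 1 (N + 1), a n * tailWeight w₀ n := by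
    unfold partialSum
    rw [← Finset.sum_add_distrib]
    refine Finset.sum_congr rfl fun n hn => ?_
    have hn1 : 1 ≤ n := (Finset.mem_Icc.mp hn).1
    rw [← mul_add, ← Complex.ofReal_add, headWeight_add_tailWeight hw hn1]
    push_cast; rw [mul_one_div]
  have hhead : ‖∑ n ∈ Finset.Ico 1 (N + 1), a n * headWeight w₀ n‖ ≤ 6 * η + 4 * D / N := by
    have h := norm_sum_mul_antitone_le (a := a) (f := headWeight w₀) hS 1
      (fun n hn => headWeight_succ_le w₀ hn) (fun n _ => headWeight_nonneg _ _) (N + 1)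
      (by omega)
    refine h.trans ?_
    have h1 : ∑ n ∈ Finset.Ico 1 (N + 1), headWeight w₀ n ≤ 2 := by
      calc _ ≤ ∑ n ∈ Finset.Ico 1 (N + 1), 2 * w₀ :=
            Finset.sum_le_sum fun n hn => headWeight_le hw (Finset.mem_Ico.mp hn).1
        _ = 2 := by simp [hw₀]; field_simp
    have h2 : headWeight w₀ 1 ≤ 2 * w₀ := headWeight_le hw le_rfl
    have h3 : w₀ ≤ 1 := by
      rw [hw₀, div_le_one hN0]; exact_mod_cast hN
    calc _ ≤ η * (2 + 2 * ((1 : ℕ) * (2 * 1))) + 2 * D * (2 * w₀) := by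
          gcongr; linarith
      _ = _ := by rw [hw₀]; push_cast; ring
  have htail : ‖thetaTail x w₀ - ∑ n ∈ Finset.Ico 1 (N + 1), a n * tailWeight w₀ n‖ ≤
      3 * η + 2 * D / N := by
    have hlim := (hasSum_thetaTail x hw).tendsto_sum_nat
    have hlim2 : Tendsto (fun L : ℕ => ∑ i ∈ Finset.range L,
        e (((i + 1 : ℕ) : ℝ) ^ 2 * x) * (tailWeight w₀ (i + 1) : ℂ) -
        ∑ n ∈ Finset.Ico 1 (N + 1), a n * tailWeight w₀ n) atTop
        (𝓝 (thetaTail x w₀ - ∑ n ∈ Finset.Ico 1 (N + 1), a n * tailWeight w₀ n)) :=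
      hlim.sub_const _
    refine le_of_tendsto hlim2.norm ?_
    filter_upwards [eventually_ge_atTop N] with L hL
    have e1 : ∑ i ∈ Finset.range L, e (((i + 1 : ℕ) : ℝ) ^ 2 * x) *
        (tailWeight w₀ (i + 1) : ℂ) = ∑ n ∈ Finset.Ico 1 (L + 1), a n * tailWeight w₀ n := by
      rw [Finset.sum_Ico_eq_sum_range]
      refine Finset.sum_congr (by simp) fun i _ => ?_
      rw [add_comm i 1]
    rw [e1, ← Finset.sum_Ico_consecutive _ (show 1 ≤ N + 1 by omega) (show N + 1 ≤ L + 1 by omega),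
      add_sub_cancel_left]
    have h := norm_sum_mul_antitone_le (a := a) (f := tailWeight w₀) hS (N + 1)
      (fun n hn => tailWeight_succ_le w₀ (by omega)) (fun n _ => tailWeight_nonneg _ _) (L + 1)
      (by omega)
    refine h.trans ?_
    have hw1 : 1 / w₀ = N := by rw [hw₀]; field_simp
    have h1 : ∑ n ∈ Finset.Ico (N + 1) (L + 1), tailWeight w₀ n ≤ 1 := by
      calc _ ≤ ∑ n ∈ Finset.Ico (N + 1) (L + 1), N * ((n : ℝ) ^ 2)⁻¹ := by
            refine Finset.sum_le_sum fun n hn => ?_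
            rw [← hw1]
            exact tailWeight_le hw (by have := (Finset.mem_Ico.mp hn).1; omega)
        _ = N * ∑ n ∈ Finset.Ioc N L, ((n : ℝ) ^ 2)⁻¹ := by
            rw [Finset.mul_sum]
            refine Finset.sum_congr ?_ fun _ _ => rfl
            ext n; simp
        _ ≤ N * ((N : ℝ)⁻¹ - (L : ℝ)⁻¹) := by
            gcongr; exact sum_Ioc_inv_sq_le_sub (by omega) hL
        _ ≤ N * (N : ℝ)⁻¹ := by
            gcongr
            have : 0 ≤ (L : ℝ)⁻¹ := by positivity
            linarith
        _ = 1 := mul_inv_cancel₀ hN0.ne'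
    have h2 : tailWeight w₀ (N + 1) ≤ N * (((N + 1 : ℕ) : ℝ) ^ 2)⁻¹ := by
      rw [← hw1]; exact tailWeight_le hw (by omega)
    have h3 : ((N + 1 : ℕ) : ℝ) * tailWeight w₀ (N + 1) ≤ 1 := by
      refine (mul_le_mul_of_nonneg_left h2 (by positivity)).trans ?_
      push_cast
      rw [← mul_assoc, ← div_eq_mul_inv, div_le_one (by positivity)]
      nlinarith
    have h4 : tailWeight w₀ (N + 1) ≤ 1 / N := by
      refine h2.trans ?_
      rw [← div_eq_mul_inv, div_le_div_iff₀ (by positivity) hN0]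
      push_cast; nlinarith
    calc _ ≤ η * (1 + 2 * 1) + 2 * D * (1 / N) := by gcongr
      _ = _ := by ring
  calc _ = ‖∑ n ∈ Finset.Ico 1 (N + 1), a n * headWeight w₀ n -
        (thetaTail x w₀ - ∑ n ∈ Finset.Ico 1 (N + 1), a n * tailWeight w₀ n)‖ := by
        rw [hpart]; congr 1; ring
    _ ≤ _ := (norm_sub_le _ _).trans (add_le_add hhead htail)
    _ = _ := by ring

lemma tendsto_partialSum_sub_thetaTail {x : ℝ} (hx : Irrational x) :
    Tendsto (fun N : ℕ => partialSum x N - thetaTail x (1 / N)) atTop (𝓝 0) := by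
  rw [Metric.tendsto_atTop]
  intro ε hε
  obtain ⟨D, hD, hS⟩ := exists_weylSum_bound hx (η := ε / 18) (by positivity)
  obtain ⟨N₀, hN₀⟩ := exists_nat_gt (12 * D / ε)
  refine ⟨N₀ + 1, fun N hN => ?_⟩
  rw [dist_zero_right]
  refine (partialSum_sub_thetaTail_le (by positivity) hD hS (by omega)).trans_lt ?_
  have h1 : 12 * D / ε < N := hN₀.trans (by exact_mod_cast (by omega : N₀ < N))
  have hN0 : (0 : ℝ) < N := lt_of_le_of_lt (by positivity) h1
  have : 6 * D / N < ε / 2 := by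
    rw [div_lt_iff₀ hN0]; rw [div_lt_iff₀ hε] at h1; linarith
  linarith

/-! ### Convergents and cylinders -/

lemma convergent_nonneg {x : ℝ} (hx : 0 ≤ x) (m : ℕ) : 0 ≤ x.convergent m := by
  induction m generalizing x with
  | zero => simpa using Int.floor_nonneg.mpr hx
  | succ m ih =>
    rw [Real.convergent_succ]
    have h1 : (0 : ℚ) ≤ ⌊x⌋ := by exact_mod_cast Int.floor_nonneg.mpr hx
    have h2 := ih (inv_nonneg.mpr (Int.fract_nonneg x))
    positivity

lemma one_le_convergent {x : ℝ} (hx : 1 ≤ x) (m : ℕ) : 1 ≤ x.convergent m := by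
  have h1 : (1 : ℚ) ≤ ⌊x⌋ := by
    have : (1 : ℤ) ≤ ⌊x⌋ := Int.le_floor.mpr (by simpa using hx)
    exact_mod_cast this
  cases m with
  | zero => simpa using h1
  | succ m =>
    rw [Real.convergent_succ]
    have h2 := convergent_nonneg (inv_nonneg.mpr (Int.fract_nonneg x)) m
    have : 0 ≤ ((Int.fract x)⁻¹.convergent m)⁻¹ := by positivity
    linarith

lemma fract_pos_of_irrational {x : ℝ} (hx : Irrational x) : 0 < Int.fract x := by
  refine lt_of_le_of_ne (Int.fract_nonneg x) fun h => ?_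
  refine hx ⟨⌊x⌋, ?_⟩
  have := Int.self_sub_floor x
  rw [← h] at this
  push_cast
  linarith

lemma irrational_inv_fract {x : ℝ} (hx : Irrational x) :
    Irrational (Int.fract x)⁻¹ ∧ 1 < (Int.fract x)⁻¹ := by
  have h0 := fract_pos_of_irrational hx
  refine ⟨?_, (one_lt_inv₀ h0).mpr (Int.fract_lt_one x)⟩
  rw [irrational_inv_iff]
  exact hx.sub_intCast ⌊x⌋

lemma floor_add_inv {a : ℤ} {y : ℝ} (hy : 1 < y) :
    ⌊(a : ℝ) + 1 / y⌋ = a ∧ (Int.fract ((a : ℝ) + 1 / y))⁻¹ = y := by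
  have h0 : 0 < y := by linarith
  have h1 : 1 / y < 1 := by rw [div_lt_one h0]; exact hy
  have h2 : 0 < 1 / y := by positivity
  have hf : ⌊(a : ℝ) + 1 / y⌋ = a := by
    rw [Int.floor_eq_iff]; constructor <;> linarith
  refine ⟨hf, ?_⟩
  rw [Int.fract, hf, add_sub_cancel_left, one_div, inv_inv]

/-- Matrix form of the continued fraction expansion up to index `j`, together with the
description of the corresponding cylinder. -/
lemma exists_convergent_matrix {x : ℝ} (hx : Irrational x) (j : ℕ) :
    ∃ (p q p' q' : ℤ) (t : ℝ), Irrational t ∧ 1 < t ∧ 0 < q ∧ 0 ≤ q' ∧ q' ≤ q ∧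
      (p * q' - p' * q = 1 ∨ p * q' - p' * q = -1) ∧
      (1 < x → q ≤ p ∧ q' ≤ p' ∧ p' ≤ p ∧ q + q' < p + p') ∧
      x * (q * t + q') = p * t + p' ∧
      x.convergent j = (p : ℚ) / q ∧
      (∀ m, x.convergent (j + 1 + m) =
        (p * t.convergent m + p') / (q * t.convergent m + q')) ∧
      ∀ s : ℝ, 1 < s → ∀ i ≤ j, ((p * s + p') / (q * s + q')).convergent i = x.convergent i := by
  induction j generalizing x with
  | zero =>
    obtain ⟨hy, hy1⟩ := irrational_inv_fract hx
    set y := (Int.fract x)⁻¹ with hydef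
    have hf0 := fract_pos_of_irrational hx
    refine ⟨⌊x⌋, 1, 1, 0, y, hy, hy1, one_pos, le_rfl, zero_le_one, Or.inr (by ring), ?_, ?_, ?_,
      ?_, ?_⟩
    · intro hx1
      have : (1 : ℤ) ≤ ⌊x⌋ := Int.le_floor.mpr (by push_cast; linarith)
      refine ⟨this, zero_le_one, this, by linarith⟩
    · have : x = ⌊x⌋ + Int.fract x := (Int.floor_add_fract x).symm
      push_cast
      have h2 : Int.fract x * y = 1 := mul_inv_cancel₀ hf0.ne'
      linear_combination y * this + h2
    · simp
    · intro m
      have hc := one_le_convergent hy1.le m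
      have hc0 : y.convergent m ≠ 0 := by linarith
      rw [zero_add, add_comm 1 m, Real.convergent_succ, ← hydef]
      push_cast
      field_simp
      ring
    · intro s hs i hi
      obtain rfl : i = 0 := by omega
      have : ((⌊x⌋ : ℤ) * s + (1 : ℤ)) / ((1 : ℤ) * s + (0 : ℤ)) = (⌊x⌋ : ℝ) + 1 / s := by
        have : s ≠ 0 := by linarith
        push_cast; field_simp; ring
      rw [this, Real.convergent_zero, Real.convergent_zero, (floor_add_inv hs).1]
  | succ j ih =>
    obtain ⟨hy, hy1⟩ := irrational_inv_fract hx
    set y := (Int.fract x)⁻¹ with hydef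
    have hf0 := fract_pos_of_irrational hx
    obtain ⟨P, Q, P', Q', t, ht, ht1, hQ, hQ', hQQ, hdet, hbig, hyt, hconv, htail, hcyl⟩ := ih hy
    -- The conditional inequalities hold for the complete quotient `y > 1`. They make the new
    -- denominator `P` positive and send every `s > 1` to a number above 1, so that the floor
    -- recovers the first digit.
    obtain ⟨hPQ, hPQ', hPP, hsum⟩ := hbig hy1
    have hP : 0 < P := by linarith
    have hP' : 0 ≤ P' := by linarith
    have hPr : (0 : ℝ) < P := by exact_mod_cast hP
    have hP'r : (0 : ℝ) ≤ P' := by exact_mod_cast hP'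
    have hQr : (0 : ℝ) < Q := by exact_mod_cast hQ
    have hQ'r : (0 : ℝ) ≤ Q' := by exact_mod_cast hQ'
    have hPq : (0 : ℚ) < P := by exact_mod_cast hP
    have hP'q : (0 : ℚ) ≤ P' := by exact_mod_cast hP'
    have hQq : (0 : ℚ) < Q := by exact_mod_cast hQ
    refine ⟨⌊x⌋ * P + Q, P, ⌊x⌋ * P' + Q', P', t, ht, ht1, hP, hP', hPP, ?_, ?_, ?_, ?_, ?_, ?_⟩
    · rcases hdet with h | h
      · right; linear_combination -h
      · left; linear_combination -h
    · intro hx1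
      have ha : (1 : ℤ) ≤ ⌊x⌋ := Int.le_floor.mpr (by push_cast; linarith)
      refine ⟨?_, ?_, ?_, ?_⟩ <;> nlinarith
    · have hxe : x = ⌊x⌋ + Int.fract x := (Int.floor_add_fract x).symm
      have h2 : Int.fract x * y = 1 := mul_inv_cancel₀ hf0.ne'
      push_cast
      linear_combination (P * t + P') * hxe - Int.fract x * hyt + (Q * t + Q') * h2
    · rw [Real.convergent_succ, hconv, inv_div]
      push_cast
      field_simp
    · intro m
      have hc := one_le_convergent ht1.le m
      have hA : (P : ℚ) * t.convergent m + P' ≠ 0 := by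
        have : 0 < (P : ℚ) * t.convergent m := mul_pos hPq (by linarith)
        linarith
      rw [show j + 1 + 1 + m = (j + 1 + m) + 1 by ring, Real.convergent_succ, htail, inv_div]
      push_cast
      field_simp
      ring
    · intro s hs i hi
      set ys : ℝ := (P * s + P') / (Q * s + Q') with hys
      have hden : 0 < (Q : ℝ) * s + Q' := by positivity
      have hnum : 0 < (P : ℝ) * s + P' := by positivity
      have hys1 : 1 < ys := by
        rw [hys, one_lt_div hden]
        have h1 : (Q : ℝ) ≤ P := by exact_mod_cast hPQ
        have h2 : (Q : ℝ) + Q' < P + P' := by exact_mod_cast hsum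
        nlinarith
      have hxs : ((⌊x⌋ * P + Q : ℤ) * s + (⌊x⌋ * P' + Q' : ℤ)) / ((P : ℝ) * s + P') =
          (⌊x⌋ : ℝ) + 1 / ys := by
        rw [hys, one_div_div]; push_cast; field_simp; ring
      obtain ⟨h1, h2⟩ := floor_add_inv (a := ⌊x⌋) hys1
      rw [hxs]
      cases i with
      | zero => rw [Real.convergent_zero, Real.convergent_zero, h1]
      | succ i =>
        rw [Real.convergent_succ, Real.convergent_succ, h1, h2, hcyl s hs i (by omega)]

lemma den_div_of_det {u v w z : ℤ} (hv : 0 < v) (h : u * z - w * v = 1 ∨ u * z - w * v = -1) :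
    ((((u : ℚ) / v).den : ℕ) : ℤ) = v := by
  refine Rat.den_div_eq_of_coprime hv ?_
  rw [← Int.isCoprime_iff_nat_coprime]
  rcases h with h | h
  · exact ⟨z, -w, by linear_combination h⟩
  · exact ⟨-z, w, by linear_combination -h⟩

lemma convDen_pos (x : ℝ) (j : ℕ) : 0 < convDen x j := Rat.den_pos _

/-- Growth of the denominators, quality of approximation, and size of the cylinders. -/
lemma convergent_facts {x : ℝ} (hx : Irrational x) (j : ℕ) :
    convDen x j ≤ convDen x (j + 1) ∧ 2 * convDen x j ≤ convDen x (j + 2) ∧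
    |x - x.convergent j| ≤ 1 / (convDen x j * convDen x (j + 1)) ∧
    1 / (2 * convDen x j * convDen x (j + 1)) ≤ |x - x.convergent j| ∧
    ∃ u v : ℝ, 1 / (2 * (convDen x j : ℝ) ^ 2) ≤ v - u ∧
      ∀ y ∈ Set.Ioo u v, ∀ i ≤ j, y.convergent i = x.convergent i := by
  obtain ⟨p, q, p', q', t, ht, ht1, hq, hq', hqq, hdet, -, hxt, hconv, htail, hcyl⟩ :=
    exists_convergent_matrix hx j
  set a : ℤ := ⌊t⌋ with ha
  have ha1 : 1 ≤ a := Int.le_floor.mpr (by push_cast; linarith)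
  obtain ⟨hy, hy1⟩ := irrational_inv_fract ht
  set b : ℤ := ⌊(Int.fract t)⁻¹⌋ with hb
  have hb1 : 1 ≤ b := Int.le_floor.mpr (by push_cast; linarith)
  have hd0 : ((convDen x j : ℕ) : ℤ) = q := by
    unfold convDen; rw [hconv]; exact den_div_of_det hq hdet
  have hq1 : 0 < q * a + q' := by positivity
  have hd1 : ((convDen x (j + 1) : ℕ) : ℤ) = q * a + q' := by
    have h := htail 0
    rw [Real.convergent_zero, ← ha, add_zero] at h
    have h2 : x.convergent (j + 1) = ((p * a + p' : ℤ) : ℚ) / ((q * a + q' : ℤ) : ℚ) := by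
      rw [h]; push_cast; rfl
    unfold convDen; rw [h2]
    refine den_div_of_det (z := q) (w := p) hq1 ?_
    rcases hdet with h | h
    · right; linear_combination -h
    · left; linear_combination -h
  -- The recurrence `q_{j+2} = b q_{j+1} + q_j` with `b ≥ 1` gives the doubling over two steps.
  have hd2 : ((convDen x (j + 2) : ℕ) : ℤ) = b * (q * a + q') + q := by
    have h := htail 1
    have hc1 : t.convergent 1 = a + (b : ℚ)⁻¹ := rfl
    rw [hc1] at h
    have hb0 : (b : ℚ) ≠ 0 := by exact_mod_cast (by omega : b ≠ 0)
    have hpos : 0 < b * (q * a + q') + q := by positivity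
    have h2 : x.convergent (j + 2) =
        ((b * (p * a + p') + p : ℤ) : ℚ) / ((b * (q * a + q') + q : ℤ) : ℚ) := by
      rw [show j + 2 = j + 1 + 1 by ring, h]
      have e1 : (p : ℚ) * (a + (b : ℚ)⁻¹) + p' = ((b * (p * a + p') + p : ℤ) : ℚ) / b := by
        push_cast; field_simp; ring
      have e2 : (q : ℚ) * (a + (b : ℚ)⁻¹) + q' = ((b * (q * a + q') + q : ℤ) : ℚ) / b := by
        push_cast; field_simp; ring
      rw [e1, e2, div_div_div_cancel_right₀ hb0]
    unfold convDen; rw [h2]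
    refine den_div_of_det (z := q * a + q') (w := p * a + p') hpos ?_
    rcases hdet with h | h
    · left; linear_combination h
    · right; linear_combination h
  have hd0r : (convDen x j : ℝ) = q := by exact_mod_cast hd0
  have hd1r : (convDen x (j + 1) : ℝ) = q * a + q' := by exact_mod_cast hd1
  have hqr : (0 : ℝ) < q := by exact_mod_cast hq
  have hq'r : (0 : ℝ) ≤ q' := by exact_mod_cast hq'
  have har : (1 : ℝ) ≤ a := by exact_mod_cast ha1
  have hT : 0 < (q : ℝ) * t + q' := by positivity
  have hcr : ((x.convergent j : ℚ) : ℝ) = p / q := by rw [hconv]; push_cast; rfl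
  set ε : ℝ := p' * q - p * q' with hε
  have hε1 : |ε| = 1 := by
    rcases hdet with h | h
    · have : ε = -1 := by
        have h' : (p : ℝ) * q' - p' * q = 1 := by exact_mod_cast h
        rw [hε]; linarith
      rw [this]; simp
    · have : ε = 1 := by
        have h' : (p : ℝ) * q' - p' * q = -1 := by exact_mod_cast h
        rw [hε]; linarith
      rw [this]; simp
  have hform : x - x.convergent j = ε / (q * (q * t + q')) := by
    have hx' : x = (p * t + p') / (q * t + q') := by rw [eq_div_iff hT.ne']; exact hxt
    rw [hcr, hx', hε]; field_simp; ring
  have habs : |x - x.convergent j| = 1 / (q * (q * t + q')) := by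
    rw [hform, abs_div, hε1, abs_of_pos (by positivity)]
  have hat : (a : ℝ) ≤ t := Int.floor_le t
  have hta : t < a + 1 := Int.lt_floor_add_one t
  have hA : 0 < (q : ℝ) * a + q' := by positivity
  refine ⟨?_, ?_, ?_, ?_, ?_⟩
  · zify; rw [hd0, hd1]; nlinarith
  · zify; rw [hd0, hd2]; nlinarith
  · rw [habs, hd0r, hd1r]; gcongr
  · rw [habs, hd0r, hd1r]
    apply one_div_le_one_div_of_le (by positivity)
    have : (q : ℝ) * t + q' ≤ 2 * (q * a + q') := by nlinarith
    calc (q : ℝ) * (q * t + q') ≤ q * (2 * (q * a + q')) := by gcongr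
      _ = _ := by ring
  -- The distance between `p/q` and `(p + p')/(q + q')`, the images of `s = ∞` and `s = 1`. The sign
  -- `ε` tells on which side of `p/q` the cylinder lies.
  · set ℓ : ℝ := 1 / (q * (q + q')) with hℓ
    have hℓ0 : 1 / (2 * (q : ℝ) ^ 2) ≤ ℓ := by
      apply one_div_le_one_div_of_le (by positivity)
      have : (q' : ℝ) ≤ q := by exact_mod_cast hqq
      nlinarith
    have main : ∀ δ : ℝ, 0 < δ → δ < ℓ → ∀ i ≤ j, ((p : ℝ) / q + ε * δ).convergent i = x.convergent i := by
      intro δ hδ0 hδ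
      -- Solves `q s + q' = 1/(qδ)`; the condition `δ < ℓ` is equivalent to `s > 1`.
      set s : ℝ := (1 / (q * δ) - q') / q with hs
      have hs1 : 1 < s := by
        rw [hs, lt_div_iff₀ hqr, one_mul, lt_sub_iff_add_lt, lt_div_iff₀ (by positivity)]
        rw [hℓ, lt_div_iff₀ (by positivity)] at hδ
        linarith
      have hqs : (q : ℝ) * s + q' = 1 / (q * δ) := by rw [hs]; field_simp; ring
      have : (p : ℝ) / q + ε * δ = (p * s + p') / (q * s + q') := by
        rw [hqs, hs, hε]; field_simp; ring
      rw [this]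
      exact hcyl s hs1
    rw [hd0r]
    rcases eq_or_eq_neg_of_abs_eq hε1 with h | h
    · refine ⟨p / q, p / q + ℓ, by linarith, fun y hy => ?_⟩
      have e1 : y = p / q + ε * (y - p / q) := by rw [h]; ring
      rw [e1]
      exact main _ (by linarith [hy.1]) (by linarith [hy.2])
    · refine ⟨p / q - ℓ, p / q, by linarith, fun y hy => ?_⟩
      have e1 : y = p / q + ε * (p / q - y) := by rw [h]; ring
      rw [e1]
      exact main _ (by linarith [hy.2]) (by linarith [hy.1])

/-- Two steps double the denominator and `(10/9)² < √2`, so they gain `(9/10)²`. The factor `10/9`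
covers a single step, which need not gain anything. -/
lemma inv_sqrt_convDen_le {x : ℝ} (hx : Irrational x) (j i : ℕ) :
    1 / √(convDen x (j + i) : ℝ) ≤ 10 / 9 * (9 / 10) ^ i / √(convDen x j : ℝ) := by
  have hpos : ∀ i, 0 < √(convDen x i : ℝ) := fun i =>
    Real.sqrt_pos.mpr (by exact_mod_cast convDen_pos x i)
  induction i using Nat.twoStepInduction with
  | zero =>
    rw [add_zero]; have := hpos j; gcongr; norm_num
  | one =>
    have h : (convDen x j : ℝ) ≤ convDen x (j + 1) := by
      exact_mod_cast (convergent_facts hx j).1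
    have := hpos j
    calc _ ≤ 1 / √(convDen x j : ℝ) := by gcongr
      _ = _ := by norm_num
  | more i ih _ =>
    have h : 2 * (convDen x (j + i) : ℝ) ≤ convDen x (j + (i + 2)) := by
      exact_mod_cast (convergent_facts hx (j + i)).2.1
    have h0 := hpos (j + i)
    have h1 : 100 / 81 * √(convDen x (j + i) : ℝ) ≤ √(convDen x (j + (i + 2)) : ℝ) := by
      refine Real.le_sqrt_of_sq_le ?_
      rw [mul_pow, Real.sq_sqrt (Nat.cast_nonneg _)]
      have : (0 : ℝ) ≤ convDen x (j + i) := Nat.cast_nonneg _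
      linarith
    calc _ ≤ 1 / (100 / 81 * √(convDen x (j + i) : ℝ)) := by gcongr
      _ = 81 / 100 * (1 / √(convDen x (j + i) : ℝ)) := by field_simp
      _ ≤ 81 / 100 * (10 / 9 * (9 / 10) ^ i / √(convDen x j : ℝ)) := by gcongr
      _ = _ := by ring

/-! ### Averages of the terms over cylinders -/

lemma measurable_convergent (j : ℕ) : Measurable fun x : ℝ => x.convergent j := by
  induction j with
  | zero =>
    have : Measurable fun n : ℤ => (n : ℚ) := Measurable.of_discrete
    exact this.comp Int.measurable_floor
  | succ j ih =>
    have h1 : Measurable fun p : ℤ × ℚ => (p.1 : ℚ) + p.2⁻¹ := Measurable.of_discrete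
    have h2 : Measurable fun x : ℝ => ((Int.fract x)⁻¹).convergent j :=
      ih.comp measurable_fract.inv
    exact h1.comp (Int.measurable_floor.prodMk h2)

lemma ae_irrational : ∀ᵐ x : ℝ, Irrational x :=
  (Set.countable_range ((↑) : ℚ → ℝ)).ae_notMem volume

/-- The size of a term of the continued fraction series, without the theta factor. -/
def termSize (j : ℕ) (x : ℝ) : ℝ :=
  √((convDen x (j + 1) : ℝ) / convDen x j) / √(convDen x j : ℝ)

lemma termSize_nonneg (j : ℕ) (x : ℝ) : 0 ≤ termSize j x := by unfold termSize; positivity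

lemma measurable_termSize (j : ℕ) : Measurable (termSize j) := by
  have h : ∀ j, Measurable fun x : ℝ => (convDen x j : ℝ) := fun j => by
    have : Measurable fun r : ℚ => (r.den : ℝ) := Measurable.of_discrete
    exact this.comp (measurable_convergent j)
  unfold termSize
  exact ((h (j + 1)).div (h j)).sqrt.div (h j).sqrt

lemma lintegral_inv_sqrt_right (r : ℝ) {ℓ : ℝ} (hℓ : 0 ≤ ℓ) :
    ∫⁻ y in Set.Ioc r (r + ℓ), ENNReal.ofReal (|y - r| ^ (-(1 / 2) : ℝ)) =
      ENNReal.ofReal (2 * √ℓ) := by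
  have hi : IntervalIntegrable (fun y : ℝ => (y - r) ^ (-(1 / 2) : ℝ)) volume r (r + ℓ) := by
    have := (intervalIntegral.intervalIntegrable_rpow' (a := 0) (b := ℓ)
      (r := -(1 / 2)) (by norm_num)).comp_sub_right r
    simpa [add_comm] using this
  have hI : ∫ y in Set.Ioc r (r + ℓ), (y - r) ^ (-(1 / 2) : ℝ) = 2 * √ℓ := by
    rw [← intervalIntegral.integral_of_le (by linarith),
      intervalIntegral.integral_comp_sub_right (fun y => y ^ (-(1 / 2) : ℝ)), sub_self,
      add_sub_cancel_left, integral_rpow (Or.inl (by norm_num)), Real.sqrt_eq_rpow]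
    norm_num
    ring
  rw [← hI, ofReal_integral_eq_lintegral_ofReal
    ((intervalIntegrable_iff_integrableOn_Ioc_of_le (by linarith)).mp hi)]
  · refine setLIntegral_congr_fun measurableSet_Ioc fun y hy => ?_
    rw [abs_of_pos (by linarith [hy.1])]
  · refine (ae_restrict_mem measurableSet_Ioc).mono fun y hy => ?_
    exact Real.rpow_nonneg (by linarith [hy.1]) _

lemma lintegral_inv_sqrt_ball (r : ℝ) {ℓ : ℝ} (hℓ : 0 ≤ ℓ) :
    ∫⁻ y in Set.Icc (r - ℓ) (r + ℓ), ENNReal.ofReal (|y - r| ^ (-(1 / 2) : ℝ)) ≤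
      ENNReal.ofReal (4 * √ℓ) := by
  have hsub : Set.Icc (r - ℓ) (r + ℓ) ⊆ Set.Icc (r - ℓ) r ∪ Set.Icc r (r + ℓ) := by
    rw [Set.Icc_union_Icc_eq_Icc (by linarith) (by linarith)]
  have hR : ∫⁻ y in Set.Icc r (r + ℓ), ENNReal.ofReal (|y - r| ^ (-(1 / 2) : ℝ)) =
      ENNReal.ofReal (2 * √ℓ) := by
    rw [← lintegral_inv_sqrt_right r hℓ, setLIntegral_congr Ioc_ae_eq_Icc]
  have hL : ∫⁻ y in Set.Icc (r - ℓ) r, ENNReal.ofReal (|y - r| ^ (-(1 / 2) : ℝ)) =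
      ENNReal.ofReal (2 * √ℓ) := by
    have hmp : MeasurePreserving (fun y : ℝ => 2 * r - y) := Measure.measurePreserving_sub_left volume (2 * r)
    have := hmp.setLIntegral_comp_preimage (s := Set.Icc r (r + ℓ)) measurableSet_Icc
      (f := fun y => ENNReal.ofReal (|y - r| ^ (-(1 / 2) : ℝ))) (by fun_prop)
    rw [hR] at this
    rw [← this]
    have e1 : (fun y : ℝ => 2 * r - y) ⁻¹' Set.Icc r (r + ℓ) = Set.Icc (r - ℓ) r := by
      ext y; simp only [Set.mem_preimage, Set.mem_Icc]
      constructor <;> rintro ⟨h1, h2⟩ <;> constructor <;> linarith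
    rw [e1]
    refine lintegral_congr fun y => ?_
    rw [abs_sub_comm]; congr 3; ring
  calc _ ≤ _ := lintegral_mono_set hsub
    _ ≤ _ := lintegral_union_le _ _ _
    _ = ENNReal.ofReal (4 * √ℓ) := by
        rw [hL, hR, ← ENNReal.ofReal_add (by positivity) (by positivity)]
        congr 1; ring

/-- Since `q_{j+1} ≤ 1/(q_j |x - p_j/q_j|)`, a large next denominator is only an integrable
singularity at the convergent. -/
lemma termSize_le {x : ℝ} (hx : Irrational x) (j : ℕ) :
    termSize j x ≤ 1 / √(convDen x j : ℝ) * ((1 / convDen x j : ℝ) *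
      |x - x.convergent j| ^ (-(1 / 2) : ℝ)) := by
  obtain ⟨-, -, h, hlow, -⟩ := convergent_facts hx j
  have hq : (0 : ℝ) < convDen x j := by exact_mod_cast convDen_pos x j
  have hQ : (0 : ℝ) < convDen x (j + 1) := by exact_mod_cast convDen_pos x (j + 1)
  have hd : 0 < |x - x.convergent j| := lt_of_lt_of_le (by positivity) hlow
  unfold termSize
  rw [div_eq_mul_one_div, mul_comm]
  gcongr
  rw [Real.rpow_neg hd.le, ← Real.sqrt_eq_rpow]
  refine Real.sqrt_le_iff.mpr ⟨by positivity, ?_⟩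
  rw [mul_pow, inv_pow, Real.sq_sqrt hd.le]
  rw [le_div_iff₀ (by positivity)] at h
  rw [div_le_iff₀ hq, one_div_pow, ← one_div, one_div_mul_one_div, div_mul_eq_mul_div, one_mul,
    le_div_iff₀ (by positivity)]
  calc (convDen x (j + 1) : ℝ) * ((convDen x j : ℝ) ^ 2 * |x - x.convergent j|)
      = convDen x j * (|x - x.convergent j| * (convDen x j * convDen x (j + 1))) := by ring
    _ ≤ convDen x j * 1 := by gcongr
    _ = _ := mul_one _

lemma measurableSet_cfInterval (r : ℚ) (j : ℕ) : MeasurableSet (cfInterval r j) :=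
  measurableSet_Ico.inter (measurable_convergent j (measurableSet_singleton r))

lemma abs_sub_convergent_le {x : ℝ} (hx : Irrational x) (j : ℕ) :
    |x - x.convergent j| ≤ 1 / (convDen x j : ℝ) ^ 2 := by
  obtain ⟨h1, -, h, -⟩ := convergent_facts hx j
  have hq : (0 : ℝ) < convDen x j := by exact_mod_cast convDen_pos x j
  refine h.trans ?_
  rw [sq]
  have : (convDen x j : ℝ) ≤ convDen x (j + 1) := by exact_mod_cast h1
  gcongr

/-- For `q` the denominator of `s`, the cylinder lies, up to a null set, within `1/q²` of `s`. The
integral is thus at most `q^{-3/2} · 4/q`, that is `8/√q` times the lower bound `1/(2q²)` for the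
cylinder's length. Decay in `i` comes from `inv_sqrt_convDen_le`. -/
lemma lintegral_termSize_cylinder_le {r : ℚ} {j₀ i : ℕ} (s : ℚ) :
    ∫⁻ y in cfInterval r j₀ ∩ {y | y.convergent (j₀ + i) = s},
        ENNReal.ofReal (termSize (j₀ + i) y) ≤
      ENNReal.ofReal (80 / 9 * (9 / 10) ^ i / √(r.den : ℝ)) *
        volume (cfInterval r j₀ ∩ {y | y.convergent (j₀ + i) = s}) := by
  set J := cfInterval r j₀ ∩ {y | y.convergent (j₀ + i) = s} with hJ
  have hJm : MeasurableSet J := (measurableSet_cfInterval r j₀).inter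
    (measurable_convergent _ (measurableSet_singleton s))
  by_cases hne : ∃ x ∈ J, Irrational x
  swap
  · have : volume J = 0 := by
      refine measure_mono_null (t := {y | ¬ Irrational y}) ?_ (ae_iff.mp ae_irrational)
      intro y hy hyi; exact hne ⟨y, hy, hyi⟩
    rw [setLIntegral_measure_zero _ _ this]; exact zero_le
  obtain ⟨x, ⟨⟨hx01, hxr⟩, hxs⟩, hx⟩ := hne
  have hxs : x.convergent (j₀ + i) = s := hxs
  have hqs : convDen x (j₀ + i) = s.den := by unfold convDen; rw [hxs]
  have hqr : convDen x j₀ = r.den := by unfold convDen; rw [hxr]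
  have hs0 : (0 : ℝ) < s.den := by exact_mod_cast s.den_pos
  have hdecay := inv_sqrt_convDen_le hx j₀ i
  rw [hqs, hqr] at hdecay
  obtain ⟨-, -, -, -, u, v, huv, hcyl⟩ := convergent_facts hx (j₀ + i)
  rw [hqs] at huv
  have hsub : Set.Ioo u v ⊆ J := by
    intro y hy
    have h := hcyl y hy
    refine ⟨⟨?_, (h j₀ (by omega)).trans hxr⟩, (h _ le_rfl).trans hxs⟩
    have h0 := h 0 (by omega)
    rw [Real.convergent_zero, Real.convergent_zero, Int.cast_inj,
      Int.floor_eq_zero_iff.mpr hx01] at h0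
    exact Int.floor_eq_zero_iff.mp h0
  have hvol : ENNReal.ofReal (1 / (2 * (s.den : ℝ) ^ 2)) ≤ volume J := by
    calc _ ≤ ENNReal.ofReal (v - u) := ENNReal.ofReal_le_ofReal huv
      _ = volume (Set.Ioo u v) := Real.volume_Ioo.symm
      _ ≤ _ := measure_mono hsub
  set ℓ : ℝ := 1 / (s.den : ℝ) ^ 2 with hℓ
  have hℓ0 : 0 ≤ ℓ := by positivity
  have hsqrt : √ℓ = 1 / s.den := by
    rw [hℓ, ← one_div_pow, Real.sqrt_sq (by positivity)]
  have hball : ∀ᵐ y ∂volume.restrict J, y ∈ Set.Icc ((s : ℝ) - ℓ) (s + ℓ) ∧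
      ENNReal.ofReal (termSize (j₀ + i) y) ≤ ENNReal.ofReal (1 / √(s.den : ℝ) * (1 / s.den)) *
        ENNReal.ofReal (|y - s| ^ (-(1 / 2) : ℝ)) := by
    filter_upwards [ae_restrict_mem hJm, ae_restrict_of_ae ae_irrational] with y hy hyi
    have hys : y.convergent (j₀ + i) = s := hy.2
    have hqy : convDen y (j₀ + i) = s.den := by unfold convDen; rw [hys]
    have h1 := abs_sub_convergent_le hyi (j₀ + i)
    have h2 := termSize_le hyi (j₀ + i)
    rw [hqy, hys] at h1 h2
    refine ⟨?_, ?_⟩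
    · rw [abs_le] at h1; constructor <;> linarith [h1.1, h1.2]
    · rw [← ENNReal.ofReal_mul (by positivity), mul_assoc]
      exact ENNReal.ofReal_le_ofReal h2
  calc _ ≤ ∫⁻ y in J, (Set.Icc ((s : ℝ) - ℓ) (s + ℓ)).indicator (fun y =>
          ENNReal.ofReal (1 / √(s.den : ℝ) * (1 / s.den)) *
          ENNReal.ofReal (|y - s| ^ (-(1 / 2) : ℝ))) y := by
        refine lintegral_mono_ae (hball.mono fun y hy => ?_)
        rw [Set.indicator_of_mem hy.1]; exact hy.2
    _ ≤ ∫⁻ y, (Set.Icc ((s : ℝ) - ℓ) (s + ℓ)).indicator (fun y =>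
          ENNReal.ofReal (1 / √(s.den : ℝ) * (1 / s.den)) *
          ENNReal.ofReal (|y - s| ^ (-(1 / 2) : ℝ))) y := setLIntegral_le_lintegral _ _
    _ = ENNReal.ofReal (1 / √(s.den : ℝ) * (1 / s.den)) *
          ∫⁻ y in Set.Icc ((s : ℝ) - ℓ) (s + ℓ), ENNReal.ofReal (|y - s| ^ (-(1 / 2) : ℝ)) := by
        rw [lintegral_indicator measurableSet_Icc, lintegral_const_mul' _ _ ENNReal.ofReal_ne_top]
    _ ≤ ENNReal.ofReal (1 / √(s.den : ℝ) * (1 / s.den)) * ENNReal.ofReal (4 * √ℓ) := by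
        gcongr; exact lintegral_inv_sqrt_ball _ hℓ0
    _ = ENNReal.ofReal (8 * (1 / √(s.den : ℝ))) * ENNReal.ofReal (1 / (2 * (s.den : ℝ) ^ 2)) := by
        rw [← ENNReal.ofReal_mul (by positivity), ← ENNReal.ofReal_mul (by positivity), hsqrt]
        congr 1; field_simp; ring
    _ ≤ _ := by
        gcongr
        calc 8 * (1 / √(s.den : ℝ)) ≤ 8 * (10 / 9 * (9 / 10) ^ i / √(r.den : ℝ)) := by gcongr
          _ = _ := by ring

lemma lintegral_termSize_le (r : ℚ) (j₀ i : ℕ) :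
    ∫⁻ y in cfInterval r j₀, ENNReal.ofReal (termSize (j₀ + i) y) ≤
      ENNReal.ofReal (80 / 9 * (9 / 10) ^ i / √(r.den : ℝ)) * volume (cfInterval r j₀) := by
  have hU : cfInterval r j₀ =
      ⋃ s : ℚ, cfInterval r j₀ ∩ {y | y.convergent (j₀ + i) = s} := by
    ext y; simp
  have hm : ∀ s : ℚ, MeasurableSet (cfInterval r j₀ ∩ {y | y.convergent (j₀ + i) = s}) :=
    fun s => (measurableSet_cfInterval r j₀).inter
      (measurable_convergent _ (measurableSet_singleton s))
  have hd : Pairwise (Function.onFun Disjoint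
      fun s : ℚ => cfInterval r j₀ ∩ {y | y.convergent (j₀ + i) = s}) := by
    intro s t hst
    refine Set.disjoint_left.mpr fun y hy hy' => hst ?_
    exact (hy.2 : y.convergent (j₀ + i) = s).symm.trans hy'.2
  calc _ = ∑' s : ℚ, ∫⁻ y in cfInterval r j₀ ∩ {y | y.convergent (j₀ + i) = s},
        ENNReal.ofReal (termSize (j₀ + i) y) := by
        conv_lhs => rw [hU]
        exact lintegral_iUnion hm hd _
    _ ≤ ∑' s : ℚ, ENNReal.ofReal (80 / 9 * (9 / 10) ^ i / √(r.den : ℝ)) *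
        volume (cfInterval r j₀ ∩ {y | y.convergent (j₀ + i) = s}) :=
        ENNReal.tsum_le_tsum fun s => lintegral_termSize_cylinder_le s
    _ = _ := by
        rw [ENNReal.tsum_mul_left, ← measure_iUnion hd hm, ← hU]

lemma lintegral_tsum_termSize_le (r : ℚ) (j₀ : ℕ) :
    ∫⁻ y in cfInterval r j₀, ∑' i, ENNReal.ofReal (termSize (j₀ + i) y) ≤
      ENNReal.ofReal (100 / √(r.den : ℝ)) * volume (cfInterval r j₀) := by
  rw [lintegral_tsum fun i => (measurable_termSize _).ennreal_ofReal.aemeasurable]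
  refine (ENNReal.tsum_le_tsum fun i => lintegral_termSize_le r j₀ i).trans ?_
  rw [ENNReal.tsum_mul_right]
  gcongr
  have hg := (hasSum_geometric_of_lt_one (r := (9 / 10 : ℝ)) (by norm_num) (by norm_num)).mul_left
    (80 / 9 / √(r.den : ℝ))
  have hg' : HasSum (fun i : ℕ => 80 / 9 * (9 / 10 : ℝ) ^ i / √(r.den : ℝ))
      (80 / 9 / √(r.den : ℝ) * (1 - 9 / 10)⁻¹) := by
    have : (fun i : ℕ => 80 / 9 * (9 / 10 : ℝ) ^ i / √(r.den : ℝ)) =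
        fun i => 80 / 9 / √(r.den : ℝ) * (9 / 10) ^ i := by
      funext i; ring
    rw [this]; exact hg
  rw [← ENNReal.ofReal_tsum_of_nonneg (fun i => by positivity) hg'.summable, hg'.tsum_eq]
  refine ENNReal.ofReal_le_ofReal ?_
  rw [div_mul_eq_mul_div]
  gcongr
  norm_num

/-! ### Equivalence of the two series -/

/-- A term of the continued fraction series. -/
def convTerm (x : ℝ) (j : ℕ) : ℂ :=
  theta (x.convergent j) / (√(convDen x j : ℝ) : ℂ) *
    (Real.log ((convDen x (j + 1) : ℝ) / (convDen x j : ℝ)) : ℂ)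

/-- The crude bound `log R ≤ 2√R` trades the logarithm for a quantity that is easy to integrate over
cylinders. -/
lemma norm_convTerm_le {x : ℝ} (hx : Irrational x) (j : ℕ) : ‖convTerm x j‖ ≤ 3 * termSize j x := by
  have hq : (0 : ℝ) < convDen x j := by exact_mod_cast convDen_pos x j
  have hQ : (0 : ℝ) < convDen x (j + 1) := by exact_mod_cast convDen_pos x (j + 1)
  have hs := Real.sqrt_pos.mpr hq
  set R : ℝ := (convDen x (j + 1) : ℝ) / convDen x j with hR
  have hR1 : 0 < R := by positivity
  have hlog : |Real.log R| ≤ 2 * √R := by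
    have hR2 : 1 ≤ R := by
      rw [hR, one_le_div hq]; exact_mod_cast (convergent_facts hx j).1
    have h1 : Real.log R = 2 * Real.log √R := by
      rw [Real.log_sqrt (by positivity)]; ring
    have h2 := Real.log_le_sub_one_of_pos (x := √R) (by positivity)
    rw [abs_of_nonneg (Real.log_nonneg hR2)]
    linarith
  unfold convTerm termSize
  rw [← hR, norm_mul, norm_div, Complex.norm_real, Complex.norm_real,
    Real.norm_of_nonneg hs.le, Real.norm_eq_abs]
  calc _ ≤ 3 / 2 / √(convDen x j : ℝ) * (2 * √R) := by
        gcongr; exact (norm_theta_le _).trans sqrt_two_le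
    _ = _ := by ring

lemma thetaTail_arc {x : ℝ} (hx : Irrational x) (j : ℕ) :
    ‖thetaTail x (1 / convDen x (j + 1)) - thetaTail x (1 / convDen x j) - 1 / 2 * convTerm x j‖ ≤
      11 / √(convDen x j : ℝ) ∧
    ∀ N : ℕ, convDen x j ≤ N → N ≤ convDen x (j + 1) →
      ‖thetaTail x (1 / N) - thetaTail x (1 / convDen x j)‖ ≤
        1 / 2 * ‖convTerm x j‖ + 11 / √(convDen x j : ℝ) := by
  obtain ⟨h1, -, h3, h4, -⟩ := convergent_facts hx j
  have hq : (0 : ℝ) < convDen x j := by exact_mod_cast convDen_pos x j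
  have h1r : (convDen x j : ℝ) ≤ convDen x (j + 1) := by exact_mod_cast h1
  obtain ⟨hA, hB⟩ := arc_estimate (x.convergent j) x (convDen x (j + 1)) h1r h4 h3
  have hdiff : ∀ N : ℕ, convDen x j ≤ N → thetaTail x (1 / N) - thetaTail x (1 / convDen x j) =
      ∫ w in (1 / (N : ℝ))..(1 / convDen x j), (thetaAt x w - 1) := by
    intro N hN
    have hNr : (convDen x j : ℝ) ≤ N := by exact_mod_cast hN
    have hN0 : (0 : ℝ) < N := hq.trans_le hNr
    rw [thetaTail_sub x (a := 1 / N) (b := 1 / convDen x j) (by positivity) (by gcongr),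
      add_sub_cancel_right]
  refine ⟨?_, fun N hN hN' => ?_⟩
  · rw [hdiff _ h1]; exact hA
  · rw [hdiff _ hN]
    have hNr : (convDen x j : ℝ) ≤ N := by exact_mod_cast hN
    have hNr' : (N : ℝ) ≤ convDen x (j + 1) := by exact_mod_cast hN'
    have hN0 : (0 : ℝ) < N := hq.trans_le hNr
    exact hB (1 / N) (by gcongr) (by unfold convDen at *; gcongr)

lemma convDen_mono {x : ℝ} (hx : Irrational x) : Monotone (convDen x) :=
  monotone_nat_of_le_succ fun j => (convergent_facts hx j).1

lemma convPartialSum_add {x : ℝ} (hx : Irrational x) (j₀ k : ℕ) :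
    convPartialSum (convDen x j₀) x (j₀ + k) =
      ∑ i ∈ Finset.range k, 1 / 2 * convTerm x (j₀ + i) := by
  unfold convPartialSum
  rw [← Finset.mul_sum]
  congr 1
  rw [Finset.sum_filter, Finset.sum_range_add]
  have h1 : ∀ j ∈ Finset.range j₀, (if convDen x j₀ ≤ convDen x j then
      theta (x.convergent j) / (√(convDen x j : ℝ) : ℂ) *
        (Real.log ((convDen x (j + 1) : ℝ) / (convDen x j : ℝ)) : ℂ) else 0) = 0 := by
    intro j hj
    split_ifs with h
    · have hj' : j < j₀ := Finset.mem_range.mp hj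
      have e1 : convDen x (j + 1) = convDen x j :=
        le_antisymm ((convDen_mono hx hj').trans h) (convDen_mono hx j.le_succ)
      have hq : (convDen x j : ℝ) ≠ 0 := by exact_mod_cast (convDen_pos x j).ne'
      rw [e1, div_self hq]; simp
    · rfl
  rw [Finset.sum_eq_zero h1, zero_add]
  refine Finset.sum_congr rfl fun i _ => ?_
  rw [if_pos (convDen_mono hx (by omega))]
  rfl

lemma tendsto_inv_sqrt_convDen {x : ℝ} (hx : Irrational x) (j₀ : ℕ) :
    Tendsto (fun k => 1 / √(convDen x (j₀ + k) : ℝ)) atTop (𝓝 0) := by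
  refine squeeze_zero (fun k => by positivity) (fun k => inv_sqrt_convDen_le hx j₀ k) ?_
  have := ((tendsto_pow_atTop_nhds_zero_of_lt_one (r := (9 / 10 : ℝ)) (by norm_num)
    (by norm_num)).const_mul (10 / 9)).div_const √(convDen x j₀ : ℝ)
  simpa using this

lemma tendsto_convDen {x : ℝ} (hx : Irrational x) (j₀ : ℕ) :
    Tendsto (fun k => convDen x (j₀ + k)) atTop atTop := by
  have hpos : ∀ k, 0 < √(convDen x (j₀ + k) : ℝ) := fun k =>
    Real.sqrt_pos.mpr (by exact_mod_cast convDen_pos x _)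
  have h1 : Tendsto (fun k => 1 / √(convDen x (j₀ + k) : ℝ)) atTop (𝓝[>] 0) :=
    tendsto_nhdsWithin_iff.mpr ⟨tendsto_inv_sqrt_convDen hx j₀,
      Eventually.of_forall fun k => one_div_pos.mpr (hpos k)⟩
  have h2 := tendsto_inv_nhdsGT_zero.comp h1
  rw [← tendsto_natCast_atTop_iff (R := ℝ)]
  refine tendsto_atTop_mono (fun k => ?_) h2
  have h3 : (1 : ℝ) ≤ convDen x (j₀ + k) := by exact_mod_cast convDen_pos x _
  simp only [Function.comp_apply, one_div, inv_inv]
  exact Real.sqrt_le_iff.mpr ⟨by positivity, by nlinarith⟩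

/-- Comparison of the smoothed series with the continued fraction series. -/
lemma exists_remainder {x : ℝ} (hx : Irrational x) (j₀ : ℕ) :
    ∃ R : ℂ, ‖R‖ ≤ 123 / √(convDen x j₀ : ℝ) ∧
      Tendsto (fun k => thetaTail x (1 / convDen x (j₀ + k)) -
        convPartialSum (convDen x j₀) x (j₀ + k)) atTop
        (𝓝 (thetaTail x (1 / convDen x j₀) + R)) := by
  set ε : ℕ → ℂ := fun i => thetaTail x (1 / convDen x (j₀ + i + 1)) -
    thetaTail x (1 / convDen x (j₀ + i)) - 1 / 2 * convTerm x (j₀ + i) with hε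
  have hb : ∀ i, ‖ε i‖ ≤ 11 * (10 / 9 / √(convDen x j₀ : ℝ)) * (9 / 10) ^ i := by
    intro i
    refine (thetaTail_arc hx (j₀ + i)).1.trans ?_
    calc 11 / √(convDen x (j₀ + i) : ℝ) = 11 * (1 / √(convDen x (j₀ + i) : ℝ)) := by ring
      _ ≤ 11 * (10 / 9 * (9 / 10) ^ i / √(convDen x j₀ : ℝ)) := by
          exact mul_le_mul_of_nonneg_left (inv_sqrt_convDen_le hx j₀ i) (by norm_num)
      _ = _ := by ring
  have hg := (hasSum_geometric_of_lt_one (r := (9 / 10 : ℝ)) (by norm_num) (by norm_num)).mul_left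
    (11 * (10 / 9 / √(convDen x j₀ : ℝ)))
  have hs : Summable ε := Summable.of_norm_bounded hg.summable hb
  refine ⟨∑' i, ε i, ?_, ?_⟩
  · refine (tsum_of_norm_bounded hg hb).trans ?_
    -- The arc errors sum to `11 · (10/9) · 10 = 1100/9 < 123`.
    have : 11 * (10 / 9 / √(convDen x j₀ : ℝ)) * (1 - 9 / 10)⁻¹ =
        (1100 / 9) / √(convDen x j₀ : ℝ) := by ring
    rw [this]
    gcongr; norm_num
  · refine (hs.hasSum.tendsto_sum_nat.const_add (thetaTail x (1 / convDen x j₀))).congr fun k => ?_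
    rw [convPartialSum_add hx]
    simp only [hε]
    have htel := Finset.sum_range_sub (fun i => thetaTail x (1 / convDen x (j₀ + i))) k
    simp only [add_zero, ← add_assoc] at htel
    rw [Finset.sum_sub_distrib, htel]
    ring

lemma exists_convDen_between {x : ℝ} (hx : Irrational x) (j₀ K N : ℕ)
    (hN : convDen x (j₀ + K) ≤ N) :
    ∃ k, K ≤ k ∧ convDen x (j₀ + k) ≤ N ∧ N ≤ convDen x (j₀ + k + 1) := by
  have hex : ∃ k, N < convDen x (j₀ + k) :=
    ((tendsto_convDen hx j₀).eventually_gt_atTop N).exists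
  classical
  have hm := Nat.find_spec hex
  set m := Nat.find hex with hmdef
  have hKm : K < m := by
    by_contra h
    have := convDen_mono hx (show j₀ + m ≤ j₀ + K by omega)
    omega
  refine ⟨m - 1, by omega, ?_, ?_⟩
  · exact not_lt.mp (Nat.find_min hex (show m - 1 < m by omega))
  · rw [show j₀ + (m - 1) + 1 = j₀ + m by omega]; exact hm.le

/-- The remainder estimate only sees the scales `N = q_k`. For `q_k ≤ N ≤ q_{k+1}` the smoothed
series moves by at most half the `k`-th term plus `O(1/√q_k)`, which tends to 0 as the terms of a
convergent series do. -/
lemma tendsto_partialSum_of_convPartialSum {x : ℝ} (hx : Irrational x) (j₀ : ℕ) {S R : ℂ}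
    (hS : Tendsto (convPartialSum (convDen x j₀) x) atTop (𝓝 S))
    (hR : Tendsto (fun k => thetaTail x (1 / convDen x (j₀ + k)) -
        convPartialSum (convDen x j₀) x (j₀ + k)) atTop
        (𝓝 (thetaTail x (1 / convDen x j₀) + R))) :
    Tendsto (partialSum x) atTop (𝓝 (thetaTail x (1 / convDen x j₀) + R + S)) := by
  set L := thetaTail x (1 / convDen x j₀) + R + S with hL
  have hshift : Tendsto (fun k => j₀ + k) atTop atTop :=
    tendsto_atTop_mono (fun k => Nat.le_add_left k j₀) tendsto_id
  have hS' := hS.comp hshift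
  have hB : Tendsto (fun k => thetaTail x (1 / convDen x (j₀ + k))) atTop (𝓝 L) := by
    refine (hR.add hS').congr fun k => ?_
    simp
  have hc : Tendsto (fun k => ‖1 / 2 * convTerm x (j₀ + k)‖) atTop (𝓝 0) := by
    have h1 := (hS'.comp (tendsto_add_atTop_nat 1)).sub hS'
    rw [sub_self] at h1
    have h2 := h1.norm
    rw [norm_zero] at h2
    refine h2.congr fun k => ?_
    simp only [Function.comp_apply]
    rw [convPartialSum_add hx, convPartialSum_add hx, Finset.sum_range_succ, add_sub_cancel_left]
  have hE : Tendsto (fun k => ‖thetaTail x (1 / convDen x (j₀ + k)) - L‖ +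
      (‖1 / 2 * convTerm x (j₀ + k)‖ + 11 * (1 / √(convDen x (j₀ + k) : ℝ)))) atTop (𝓝 0) := by
    have h1 : Tendsto (fun k => ‖thetaTail x (1 / convDen x (j₀ + k)) - L‖) atTop (𝓝 0) := by
      have := (hB.sub_const L).norm
      simpa using this
    have := h1.add (hc.add ((tendsto_inv_sqrt_convDen hx j₀).const_mul 11))
    simpa using this
  have hT : Tendsto (fun N : ℕ => thetaTail x (1 / N)) atTop (𝓝 L) := by
    rw [Metric.tendsto_atTop]
    intro δ hδ
    obtain ⟨K, hK⟩ := eventually_atTop.mp (hE.eventually_lt_const hδ)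
    refine ⟨convDen x (j₀ + K), fun N hN => ?_⟩
    obtain ⟨k, hk, h1, h2⟩ := exists_convDen_between hx j₀ K N hN
    rw [dist_eq_norm]
    have h3 := (thetaTail_arc hx (j₀ + k)).2 N h1 h2
    refine lt_of_le_of_lt ?_ (hK k hk)
    calc _ = ‖(thetaTail x (1 / convDen x (j₀ + k)) - L) +
          (thetaTail x (1 / N) - thetaTail x (1 / convDen x (j₀ + k)))‖ := by congr 1; ring
      _ ≤ _ := (norm_add_le _ _).trans (by
          gcongr
          refine h3.trans (le_of_eq ?_)
          rw [norm_mul]; norm_num; ring)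
  have := (tendsto_partialSum_sub_thetaTail hx).add hT
  simpa using this

/-- Convergence of `F` is used only along `N = q_k`; the converse has to control all intermediate
`N`. -/
lemma seriesConverges_iff {x : ℝ} (hx : Irrational x) (j₀ : ℕ) :
    SeriesConverges x ↔
      ∃ S : ℂ, Tendsto (convPartialSum (convDen x j₀) x) atTop (𝓝 S) := by
  obtain ⟨R, -, hR⟩ := exists_remainder hx j₀
  constructor
  · rintro ⟨z, hz⟩
    have h1 : Tendsto (fun N : ℕ => thetaTail x (1 / N)) atTop (𝓝 z) := by
      have := hz.sub (tendsto_partialSum_sub_thetaTail hx)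
      simpa using this
    have h2 := h1.comp (tendsto_convDen hx j₀)
    have h3 := h2.sub hR
    refine ⟨_, (tendsto_add_atTop_iff_nat j₀).mp (h3.congr fun k => ?_)⟩
    simp only [Function.comp_apply]
    rw [add_comm k j₀]; ring
  · rintro ⟨S, hS⟩
    exact ⟨_, tendsto_partialSum_of_convPartialSum hx j₀ hS hR⟩

lemma norm_F_sub_thetaTail_le {x : ℝ} (hx : Irrational x) (j₀ : ℕ) {S : ℂ}
    (hS : Tendsto (convPartialSum (convDen x j₀) x) atTop (𝓝 S)) :
    ‖F x - thetaTail x (1 / convDen x j₀) - S‖ ≤ 123 / √(convDen x j₀ : ℝ) := by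
  obtain ⟨R, hRn, hR⟩ := exists_remainder hx j₀
  have : F x = thetaTail x (1 / convDen x j₀) + R + S :=
    (tendsto_partialSum_of_convPartialSum hx j₀ hS hR).limUnder_eq
  rw [this]
  refine le_of_eq_of_le ?_ hRn
  congr 1; ring

/-! ### Almost everywhere convergence and the mean of `F` -/

lemma volume_cfInterval_pos {r : ℚ} {j₀ : ℕ} {x : ℝ} (hxI : x ∈ cfInterval r j₀)
    (hx : Irrational x) : 0 < volume (cfInterval r j₀) := by
  obtain ⟨-, -, -, -, u, v, huv, hcyl⟩ := convergent_facts hx j₀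
  have hq : (0 : ℝ) < convDen x j₀ := by exact_mod_cast convDen_pos x j₀
  have huv' : 0 < v - u := lt_of_lt_of_le (by positivity) huv
  have hsub : Set.Ioo u v ⊆ cfInterval r j₀ := by
    intro y hy
    have h := hcyl y hy
    refine ⟨?_, (h j₀ le_rfl).trans hxI.2⟩
    have h0 := h 0 (Nat.zero_le _)
    rw [Real.convergent_zero, Real.convergent_zero, Int.cast_inj,
      Int.floor_eq_zero_iff.mpr hxI.1] at h0
    exact Int.floor_eq_zero_iff.mp h0
  refine lt_of_lt_of_le ?_ (measure_mono hsub)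
  rw [Real.volume_Ioo]
  exact ENNReal.ofReal_pos.mpr huv'

lemma volume_cfInterval_ne_top (r : ℚ) (j₀ : ℕ) : volume (cfInterval r j₀) ≠ ⊤ := by
  have h : cfInterval r j₀ ⊆ Set.Ico 0 1 := fun x hx => hx.1
  exact measure_ne_top_of_subset h (by simp)

lemma ae_tsum_termSize_lt_top (r : ℚ) (j₀ : ℕ) : ∀ᵐ y ∂volume.restrict (cfInterval r j₀),
    ∑' i, ENNReal.ofReal (termSize (j₀ + i) y) < ⊤ := by
  refine ae_lt_top' ?_ ?_
  · exact (Measurable.tsum fun i =>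
      (measurable_termSize _).ennreal_ofReal).aemeasurable
  · exact ((lintegral_tsum_termSize_le r j₀).trans_lt
      (ENNReal.mul_lt_top ENNReal.ofReal_lt_top
        (lt_top_iff_ne_top.mpr (volume_cfInterval_ne_top r j₀)))).ne

lemma exists_convPartialSum_limit {y : ℝ} (hy : Irrational y) (j₀ : ℕ)
    (hfin : ∑' i, ENNReal.ofReal (termSize (j₀ + i) y) < ⊤) :
    ∃ S : ℂ, Tendsto (convPartialSum (convDen y j₀) y) atTop (𝓝 S) ∧
      ‖S‖ₑ ≤ ENNReal.ofReal (3 / 2) * ∑' i, ENNReal.ofReal (termSize (j₀ + i) y) := by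
  have hs : Summable fun i => termSize (j₀ + i) y := by
    have := ENNReal.summable_toReal hfin.ne
    refine this.congr fun i => ENNReal.toReal_ofReal (termSize_nonneg _ _)
  have hb : ∀ i, ‖1 / 2 * convTerm y (j₀ + i)‖ ≤ 3 / 2 * termSize (j₀ + i) y := by
    intro i
    rw [norm_mul]
    have := norm_convTerm_le hy (j₀ + i)
    norm_num
    linarith
  have hg := hs.hasSum.mul_left (3 / 2)
  have hc : Summable fun i => 1 / 2 * convTerm y (j₀ + i) := Summable.of_norm_bounded hg.summable hb
  refine ⟨∑' i, 1 / 2 * convTerm y (j₀ + i), ?_, ?_⟩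
  · refine (tendsto_add_atTop_iff_nat j₀).mp (hc.hasSum.tendsto_sum_nat.congr fun k => ?_)
    rw [add_comm k j₀, convPartialSum_add hy]
  · rw [← ofReal_norm, ← ENNReal.ofReal_tsum_of_nonneg (fun i => termSize_nonneg _ _) hs,
      ← ENNReal.ofReal_mul (by norm_num)]
    exact ENNReal.ofReal_le_ofReal (tsum_of_norm_bounded hg hb)

lemma ae_seriesConverges (r : ℚ) (j₀ : ℕ) :
    ∀ᵐ y ∂volume.restrict (cfInterval r j₀), SeriesConverges y := by
  filter_upwards [ae_tsum_termSize_lt_top r j₀, ae_restrict_of_ae ae_irrational] with y hfin hy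
  obtain ⟨S, hS, -⟩ := exists_convPartialSum_limit hy j₀ hfin
  exact (seriesConverges_iff hy j₀).mpr ⟨S, hS⟩

lemma aestronglyMeasurable_F (r : ℚ) (j₀ : ℕ) :
    AEStronglyMeasurable F (volume.restrict (cfInterval r j₀)) := by
  refine aestronglyMeasurable_of_tendsto_ae atTop (f := fun N x => partialSum x N) (fun N => ?_) ?_
  · refine Continuous.aestronglyMeasurable ?_
    unfold partialSum e
    fun_prop
  · filter_upwards [ae_seriesConverges r j₀] with y hy
    exact tendsto_nhds_limUnder hy

/-- At almost every `y`, `F y` differs from the constant by the remainder (123), the variation of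
the smoothed series between `y` and `x` (64), and the continued fraction sum, whose average is at
most `(3/2) · 100`; all in units of `1/√q`. -/
lemma lintegral_F_sub_le {r : ℚ} {j₀ : ℕ} {x : ℝ} (hxI : x ∈ cfInterval r j₀)
    (hx : Irrational x) :
    ∫⁻ y in cfInterval r j₀, ‖F y - thetaTail x (1 / r.den)‖ₑ ≤
      ENNReal.ofReal (337 / √(r.den : ℝ)) * volume (cfInterval r j₀) := by
  have hden : ∀ {y}, y ∈ cfInterval r j₀ → convDen y j₀ = r.den := fun {y} hy => by
    unfold convDen; rw [hy.2]
  have hdist : ∀ {y}, y ∈ cfInterval r j₀ → Irrational y → |y - r| ≤ 1 / (r.den : ℝ) ^ 2 :=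
    fun {y} hy hyi => by
      have := abs_sub_convergent_le hyi j₀
      rwa [hden hy, hy.2] at this
  calc _ ≤ ∫⁻ y in cfInterval r j₀, (ENNReal.ofReal (187 / √(r.den : ℝ)) +
        ENNReal.ofReal (3 / 2) * ∑' i, ENNReal.ofReal (termSize (j₀ + i) y)) := by
        refine lintegral_mono_ae ?_
        filter_upwards [ae_tsum_termSize_lt_top r j₀, ae_restrict_of_ae ae_irrational,
          ae_restrict_mem (measurableSet_cfInterval r j₀)] with y hfin hy hyI
        obtain ⟨S, hS, hSn⟩ := exists_convPartialSum_limit hy j₀ hfin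
        have h1 := norm_F_sub_thetaTail_le hy j₀ hS
        have h2 := norm_thetaTail_sub_le r (hdist hyI hy) (hdist hxI hx)
        rw [hden hyI] at h1
        have h3 : F y - thetaTail x (1 / r.den) = ((F y - thetaTail y (1 / r.den) - S) +
            (thetaTail y (1 / r.den) - thetaTail x (1 / r.den))) + S := by ring
        rw [h3]
        refine (enorm_add_le _ _).trans (add_le_add ?_ hSn)
        rw [← ofReal_norm]
        refine ENNReal.ofReal_le_ofReal ((norm_add_le _ _).trans ?_)
        calc _ ≤ 123 / √(r.den : ℝ) + 64 / √(r.den : ℝ) := add_le_add h1 h2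
          _ = _ := by ring
    _ = ENNReal.ofReal (187 / √(r.den : ℝ)) * volume (cfInterval r j₀) +
        ENNReal.ofReal (3 / 2) *
          ∫⁻ y in cfInterval r j₀, ∑' i, ENNReal.ofReal (termSize (j₀ + i) y) := by
        rw [lintegral_add_left measurable_const, setLIntegral_const,
          lintegral_const_mul' _ _ ENNReal.ofReal_ne_top]
    _ ≤ ENNReal.ofReal (187 / √(r.den : ℝ)) * volume (cfInterval r j₀) +
        ENNReal.ofReal (3 / 2) *
          (ENNReal.ofReal (100 / √(r.den : ℝ)) * volume (cfInterval r j₀)) := by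
        gcongr; exact lintegral_tsum_termSize_le r j₀
    _ = _ := by
        rw [← mul_assoc, ← ENNReal.ofReal_mul (by norm_num), ← add_mul,
          ← ENNReal.ofReal_add (by positivity) (by positivity)]
        congr 2; ring

lemma integrableOn_F {r : ℚ} {j₀ : ℕ} {x : ℝ} (hxI : x ∈ cfInterval r j₀) (hx : Irrational x) :
    IntegrableOn F (cfInterval r j₀) := by
  have htop := lt_top_iff_ne_top.mpr (volume_cfInterval_ne_top r j₀)
  have hconst : IntegrableOn (fun _ : ℝ => thetaTail x (1 / r.den)) (cfInterval r j₀) :=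
    integrableOn_const htop.ne
  have hdiff : IntegrableOn (fun y => F y - thetaTail x (1 / r.den)) (cfInterval r j₀) :=
    ⟨(aestronglyMeasurable_F r j₀).sub aestronglyMeasurable_const,
      (lintegral_F_sub_le hxI hx).trans_lt (ENNReal.mul_lt_top ENNReal.ofReal_lt_top htop)⟩
  refine (hdiff.add hconst).congr (Eventually.of_forall fun y => ?_)
  simp

lemma norm_mean_sub_le {r : ℚ} {j₀ : ℕ} {x : ℝ} (hxI : x ∈ cfInterval r j₀)
    (hx : Irrational x) :
    ‖mean (cfInterval r j₀) - thetaTail x (1 / r.den)‖ ≤ 337 / √(r.den : ℝ) := by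
  set I := cfInterval r j₀
  set A := thetaTail x (1 / r.den)
  have htop : volume I ≠ ⊤ := volume_cfInterval_ne_top r j₀
  have hV : 0 < volume.real I :=
    ENNReal.toReal_pos (volume_cfInterval_pos hxI hx).ne' htop
  have h1 : mean I - A = (volume.real I)⁻¹ • ∫ y in I, (F y - A) := by
    rw [mean, setAverage_eq, integral_sub (integrableOn_F hxI hx)
      (integrableOn_const htop), smul_sub, setIntegral_const, smul_smul,
      inv_mul_cancel₀ hV.ne', one_smul]
  rw [h1, norm_smul, norm_inv, Real.norm_of_nonneg hV.le, inv_mul_le_iff₀ hV]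
  have h2 : ‖∫ y in I, (F y - A)‖ₑ ≤ ENNReal.ofReal (337 / √(r.den : ℝ)) * volume I :=
    (enorm_integral_le_lintegral_enorm _).trans (lintegral_F_sub_le hxI hx)
  have h3 := ENNReal.toReal_mono (ENNReal.mul_ne_top ENNReal.ofReal_ne_top htop) h2
  rw [toReal_enorm, ENNReal.toReal_mul, ENNReal.toReal_ofReal (by positivity)] at h3
  rw [mul_comm]
  exact h3

lemma cfInterval_zero : cfInterval 0 0 = Set.Ico 0 1 := by
  ext x
  simp only [cfInterval, Set.mem_ofPred_eq, Real.convergent_zero, Int.cast_eq_zero,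
    and_iff_left_iff_imp]
  exact fun h => Int.floor_eq_zero_iff.mpr h

lemma exists_irrational_mem_Ico : ∃ x ∈ Set.Ico (0 : ℝ) 1, Irrational x := by
  refine ⟨Int.fract √2, ⟨Int.fract_nonneg _, Int.fract_lt_one _⟩, ?_⟩
  exact irrational_sqrt_two.sub_intCast _

end QuadSeries

end

theorem proposition3 :
    -- the average `F_I` is meaningful: `F` is defined almost everywhere and integrable
    (∀ᵐ x ∂(volume.restrict (Set.Ico (0 : ℝ) 1)), QuadSeries.SeriesConverges x) ∧
    IntegrableOn QuadSeries.F (Set.Ico (0 : ℝ) 1) volume ∧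
    ∃ C : ℝ, ∀ (r : ℚ) (j₀ : ℕ) (x : ℝ), x ∈ QuadSeries.cfInterval r j₀ → Irrational x →
      -- both sides of the formula are defined at the same points `x`
      (QuadSeries.SeriesConverges x ↔
        ∃ S : ℂ, Tendsto (QuadSeries.convPartialSum r.den x) atTop (𝓝 S)) ∧
      ∀ S : ℂ, Tendsto (QuadSeries.convPartialSum r.den x) atTop (𝓝 S) →
        ‖QuadSeries.F x - QuadSeries.mean (QuadSeries.cfInterval r j₀) - S‖
          ≤ C / Real.sqrt (r.den : ℝ) := by
  -- `460 = 123 + 337`: the pointwise remainder plus the distance from the mean to the smoothed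
  -- series. The two global claims are the case of the cylinder `[0,1)`, with `r = 0` and `j₀ = 0`.
  refine ⟨?_, ?_, 460, fun r j₀ x hxI hx => ?_⟩
  · rw [← QuadSeries.cfInterval_zero]
    exact QuadSeries.ae_seriesConverges 0 0
  · obtain ⟨x, hx01, hx⟩ := QuadSeries.exists_irrational_mem_Ico
    rw [← QuadSeries.cfInterval_zero] at hx01 ⊢
    exact QuadSeries.integrableOn_F hx01 hx
  · have hden : QuadSeries.convDen x j₀ = r.den := by
      unfold QuadSeries.convDen; rw [hxI.2]
    rw [← hden]
    refine ⟨QuadSeries.seriesConverges_iff hx j₀, fun S hS => ?_⟩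
    have h1 := QuadSeries.norm_F_sub_thetaTail_le hx j₀ hS
    have h2 := QuadSeries.norm_mean_sub_le hxI hx
    rw [← hden] at h2
    set A := QuadSeries.thetaTail x (1 / QuadSeries.convDen x j₀)
    calc _ = ‖(QuadSeries.F x - A - S) -
          (QuadSeries.mean (QuadSeries.cfInterval r j₀) - A)‖ := by congr 1; ring
      _ ≤ _ := (norm_sub_le _ _).trans (add_le_add h1 h2)
      _ = _ := by ring
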